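/- Let $F$ be a number field of degree $d=[F:\mathbb Q]$ with ring of integers $\mathcal O_F$, and let $n\ge 1$. There is a constant $C_{F,n}$, depending at most on $F$ and $n$, such that the following holds. Let $A$ be a commutative separable $F$-algebra (a finite product of number fields containing $F$) with $\dim_F A=n$, and let $A_\infty=A\otimes_{\mathbb Q}\mathbb R=\prod_{v\mid\infty}A_v=\prod_{w\mid\infty}A_w$, where $v$ runs over the archimedean places of $F$, $w$ over the archimedean places of $A$ (ring homomorphisms $A\to\mathbb C$ up to conjugation), $A_v=A\otimes_FF_v=\prod_{w\mid v}A_w$, and each $A_w$ is $\mathbb R$ or $\mathbb C$. Embed $A$ diagonally in $A_\infty$. Let $\operatorname{vol}$ be the product measure on $A_\infty=\prod_w A_w$ of the Lebesgue measure on each real factor and twice the Lebesgue measure on each complex factor. Let $B_v=\{(x_w)_{w\mid v}:\max_{w\mid v}|x_w|\le 1\}\subseteq A_v$, where $|\cdot|$ is the usual absolute value. Let $\Lambda\subseteq A$ be an $\mathcal O_F$-lattice of rank $n$, that is, a finitely generated $\mathcal O_F$-submodule that spans $A$ over $F$. Put $\det_F\Lambda=\sqrt{N_{F/\mathbb Q}(\Delta_{\Lambda/F})}$,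 where $\Delta_{\Lambda/F}$ is the discriminant of $\Lambda$ with respect to the trace pairing $T(x,y)=\operatorname{Tr}_{A/F}(xy)$, that is, the fractional ideal of $F$ generated by all $\det(T(x_i,y_j))_{1\le i,j\le n}$ with $x_1,\dots,x_n,y_1,\dots,y_n\in\Lambda$. Let $\tau=(\tau_v)_v\colon A_\infty\to A_\infty$ be an $F_\infty$-linear map with $\det_{\mathbb R}\tau=1$, where $F_\infty=F\otimes_{\mathbb Q}\mathbb R$, and put $B'_v=\tau_v^{-1}B_v$ and $B'_\infty=\prod_{v\mid\infty}B'_v=\tau^{-1}\big(\prod_{v\mid\infty} B_v\big)$. For $1\le i\le n$ let $$\lambda_i=\inf\{\lambda\in\mathbb R_{>0}:\Lambda\cap\lambda B'_\infty\text{ contains }i\text{ vectors that are linearly independent over }F\}$$ be the successive minima of $\Lambda$ with respect to the local regions $B'_v$. Let $\mathcal S\subseteq A_\infty$ be a bounded set, let $R\ge 0$ be real and $N\ge 0$ an integer, and suppose that the boundary of $\mathcal S$ is in $\mathrm{Lip}_A(R,N)$ with respect to $B'_\infty$, that is, it is covered by the images of $N$ maps $\phi\colon[0,1)^{nd-1}\to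 A_\infty$ such that $\phi(\mathbf x)-\phi(\mathbf y)\in R\,|\mathbf x-\mathbf y|\,B'_\infty$ for all $\mathbf x,\mathbf y\in[0,1)^{nd-1}$, where $|\cdot|$ is the Euclidean norm. Then $\Lambda\cap\mathcal S$ is finite, and $$\left|\#(\Lambda\cap\mathcal S)-\frac{\operatorname{vol}(\mathcal S)}{|\Delta_{F/\mathbb Q}|^{n/2}\det_F\Lambda}\right|\le C_{F,n}\,N\left(\frac{R^{nd-1}}{(\lambda_1\cdots\lambda_{n-1})^d\lambda_n^{d-1}}+\sum_{i=0}^{n-1}\frac{R^{id}}{(\lambda_1\cdots\lambda_i)^d}\right),$$ where empty products (and $R^0$) are equal to $1$. -/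

import Mathlib

open scoped Pointwise NumberField nonZeroDivisors

noncomputable section

namespace ArchLattice

/-! ### The archimedean completion of a commutative algebra -/

/-- Complex conjugate of a ring homomorphism `K → ℂ`. -/
def conjHom {K : Type*} [CommRing K] (σ : K →+* ℂ) : K →+* ℂ :=
  (starRingEnd ℂ).comp σ

/-- The archimedean completion `K_∞ = K ⊗_ℚ ℝ` of a number field, or of a finite product `K` of
number fields, realised as the real algebra of all families `(x_σ)` of complex numbers, indexed by
the ring homomorphisms `σ : K → ℂ`, that satisfy `x_{σ̄} = conj x_σ`.  Choosing one `σ` in each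
archimedean place `w = {σ, σ̄}` identifies it with `∏_w K_w`, where `K_w = ℝ` if `σ = σ̄`, and
`K_w = ℂ` otherwise. The topology is the one induced by the product topology. -/
def Arch (K : Type*) [CommRing K] : Subalgebra ℝ ((K →+* ℂ) → ℂ) where
  carrier := {x | ∀ σ, x (conjHom σ) = starRingEnd ℂ (x σ)}
  mul_mem' := fun hx hy σ => by simp [hx σ, hy σ]
  add_mem' := fun hx hy σ => by simp [hx σ, hy σ]
  algebraMap_mem' := fun r σ => by simp

/-- The diagonal embedding `K → K_∞`. -/
def diag (K : Type*) [CommRing K] : K →+* Arch K where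
  toFun a := ⟨fun σ => σ a, fun _ => rfl⟩
  map_one' := by ext σ; simp
  map_zero' := by ext σ; simp
  map_mul' := fun a b => by ext σ; simp
  map_add' := fun a b => by ext σ; simp

/-- The ring homomorphism `F_∞ → A_∞` which makes `A_∞` an `F_∞`-algebra: on the coordinate of
`σ : A → ℂ`, it is the coordinate of the restriction of `σ` to `F`. -/
def baseMap (F A : Type*) [CommRing F] [CommRing A] [Algebra F A] : Arch F →+* Arch A where
  toFun a := ⟨fun σ => a.1 (σ.comp (algebraMap F A)), fun σ => a.2 (σ.comp (algebraMap F A))⟩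
  map_one' := by ext σ; simp
  map_zero' := by ext σ; simp
  map_mul' := fun a b => by ext σ; simp
  map_add' := fun a b => by ext σ; simp

/-- Since `ℝ ⊆ F_∞`, a map `A_∞ → A_∞` is `F_∞`-linear exactly when it is `ℝ`-linear and commutes
with the multiplication by elements of `F_∞`. -/
def IsArchLinear (F : Type*) {A : Type*} [CommRing F] [CommRing A] [Algebra F A]
    (τ : Arch A →ₗ[ℝ] Arch A) : Prop :=
  ∀ (a : Arch F) (x : Arch A), τ (baseMap F A a * x) = baseMap F A a * τ x

/-- The unit ball `B_∞ = {(x_w)_w : max_w |x_w| ≤ 1}`. It is the product over the archimedean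
places `v` of `F` of the balls `B_v = {(x_w)_{w ∣ v} : max_{w ∣ v} |x_w| ≤ 1}`. -/
def unitBall (A : Type*) [CommRing A] : Set (Arch A) :=
  {x | ∀ σ, ‖x.1 σ‖ ≤ 1}

/-- The transformed ball `B'_∞ = τ⁻¹ B_∞`. For `F_∞`-linear invertible `τ = (τ_v)_v` it is the
product of the local regions `B'_v = τ_v⁻¹ B_v`. -/
def ball {A : Type*} [CommRing A] (τ : Arch A →ₗ[ℝ] Arch A) : Set (Arch A) :=
  τ ⁻¹' unitBall A

/-! ### The measure on the archimedean completion -/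

/-- Ring homomorphisms `A → ℂ` up to complex conjugation. -/
def placeSetoid (A : Type*) [CommRing A] : Setoid (A →+* ℂ) where
  r σ ρ := ρ = σ ∨ ρ = conjHom σ
  iseqv :=
    { refl := fun _ => Or.inl rfl
      symm := by
        rintro σ ρ (rfl | rfl)
        · exact Or.inl rfl
        · right; ext x; simp [conjHom]
      trans := by
        rintro σ ρ κ (rfl | rfl) (rfl | rfl)
        · exact Or.inl rfl
        · exact Or.inr rfl
        · exact Or.inr rfl
        · left; ext x; simp [conjHom] }

/-- The archimedean places of `A`. -/
def Place (A : Type*) [CommRing A] : Type _ := Quotient (placeSetoid A)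

/-- A chosen representative of an archimedean place. -/
def Place.hom {A : Type*} [CommRing A] (w : Place A) : A →+* ℂ := Quotient.out w

/-- A place is real if it is given by a homomorphism to `ℝ`; otherwise it is complex. -/
def Place.IsReal {A : Type*} [CommRing A] (w : Place A) : Prop := conjHom w.hom = w.hom

/-- The identification of `A_∞` with `∏_{w real} ℝ × ∏_{w complex} ℂ`. -/
def coords (A : Type*) [CommRing A] (x : Arch A) :
    ({w : Place A // w.IsReal} → ℝ) × ({w : Place A // ¬ w.IsReal} → ℂ) :=
  (fun w => (x.1 w.1.hom).re, fun w => x.1 w.1.hom)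

theorem finite_hom (F A : Type*) [Field F] [NumberField F] [CommRing A] [Algebra F A]
    [Module.Finite F A] : Finite (A →+* ℂ) := by
  let _ : Algebra ℚ A := Algebra.compHom A (algebraMap ℚ F)
  have : IsScalarTower ℚ F A := IsScalarTower.of_algebraMap_eq (fun _ => rfl)
  have : Module.Finite ℚ A := Module.Finite.trans F A
  exact Finite.of_injective (fun σ : A →+* ℂ => σ.toRatAlgHom) fun σ ρ h => by
    ext x; exact congrArg (fun f : A →ₐ[ℚ] ℂ => f x) h

theorem finite_place (F A : Type*) [Field F] [NumberField F] [CommRing A] [Algebra F A]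
    [Module.Finite F A] : Finite (Place A) :=
  haveI := finite_hom F A
  inferInstanceAs (Finite (Quotient (placeSetoid A)))

/-- The volume of a region in `A_∞ = ∏_w A_w` for the product of the normalised Haar measures: the
Lebesgue measure on the real factors and twice the Lebesgue measure on the complex factors. -/
def vol (F : Type*) {A : Type*} [Field F] [NumberField F] [CommRing A] [Algebra F A]
    [Module.Finite F A] (S : Set (Arch A)) : ℝ :=
  haveI := finite_place F A
  letI := Fintype.ofFinite {w : Place A // w.IsReal}
  letI := Fintype.ofFinite {w : Place A // ¬ w.IsReal}
  2 ^ Nat.card {w : Place A // ¬ w.IsReal} * (MeasureTheory.volume (coords A '' S)).toReal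

/-! ### Lattices -/

/-- An `𝓞 F`-lattice in `A` of full rank: a finitely generated `𝓞 F`-submodule that spans `A`
over `F`. -/
def IsLattice (F : Type*) {A : Type*} [Field F] [CommRing A] [Algebra F A]
    (L : Submodule (𝓞 F) A) : Prop :=
  L.FG ∧ Submodule.span F (L : Set A) = ⊤

/-- The determinants `det (T(x_i, y_j))`, where `x_1, …, x_n, y_1, …, y_n` run through `L`, with
`n = dim_F A` and `T` the trace pairing `T(x, y) = Tr_{A/F}(x y)`. -/
def pairingDets (F : Type*) {A : Type*} [Field F] [CommRing A] [Algebra F A]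
    (L : Submodule (𝓞 F) A) : Set F :=
  {t | ∃ x y : Fin (Module.finrank F A) → A, (∀ i, x i ∈ L) ∧ (∀ i, y i ∈ L) ∧
    t = (Matrix.of fun i j => Algebra.trace F A (x i * y j)).det}

theorem isFractional_span_pairingDets {F A : Type*} [Field F] [NumberField F] [CommRing A]
    [Algebra F A] {L : Submodule (𝓞 F) A} (hL : L.FG) :
    IsFractional (𝓞 F)⁰ (Submodule.span (𝓞 F) (pairingDets F L)) := by
  classical
  -- all values of the trace pairing on `L` lie in a finitely generated submodule `M` of `F`
  let tr : A →ₗ[𝓞 F] F := (Algebra.trace F A).restrictScalars (𝓞 F)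
  let M : Submodule (𝓞 F) F := (L * L).map tr
  have hM : M.FG := (hL.mul hL).map tr
  have key : Submodule.span (𝓞 F) (pairingDets F L) ≤ M ^ Module.finrank F A := by
    rw [Submodule.span_le]
    rintro t ⟨x, y, hx, hy, rfl⟩
    rw [Matrix.det_apply]
    refine Submodule.sum_mem _ fun σ _ => ?_
    have hprod : ∀ s : Finset (Fin (Module.finrank F A)),
        (∏ i ∈ s, (Matrix.of fun i j => Algebra.trace F A (x i * y j)) (σ i) i) ∈ M ^ s.card := by
      intro s
      induction s using Finset.induction_on with
      | empty => simp
      | insert a s ha ih =>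
        rw [Finset.prod_insert ha, Finset.card_insert_of_notMem ha, pow_succ']
        exact Submodule.mul_mem_mul
          ⟨x (σ a) * y a, Submodule.mul_mem_mul (hx _) (hy _), rfl⟩ ih
    have h := hprod Finset.univ
    rw [Finset.card_univ, Fintype.card_fin] at h
    rcases Int.units_eq_one_or (Equiv.Perm.sign σ) with h1 | h1
    · simpa [h1] using h
    · simpa [h1] using h
  have hF : IsFractional (𝓞 F)⁰ (M ^ Module.finrank F A) :=
    FractionalIdeal.isFractional_of_fg (hM.pow _)
  exact FractionalIdeal.isFractional_of_le (J := ⟨_, hF⟩) key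

/-- The discriminant `Δ_{L/F}` of a finitely generated `𝓞 F`-submodule `L ⊆ A` with respect to the
trace pairing: the fractional ideal generated by the image of the pairing on the top exterior power
of `L`. If `L` is free with basis `e_1, …, e_n`, it is generated by `det (T(e_i, e_j))`. -/
def discr (F : Type*) {A : Type*} [Field F] [NumberField F] [CommRing A] [Algebra F A]
    (L : Submodule (𝓞 F) A) (hL : L.FG) : FractionalIdeal (𝓞 F)⁰ F :=
  ⟨Submodule.span (𝓞 F) (pairingDets F L), isFractional_span_pairingDets hL⟩

/-- The determinant `det_F L = √(N_{F/ℚ}(Δ_{L/F}))`. -/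
def latticeDet (F : Type*) {A : Type*} [Field F] [NumberField F] [CommRing A] [Algebra F A]
    (L : Submodule (𝓞 F) A) (hL : L.FG) : ℝ :=
  Real.sqrt (FractionalIdeal.absNorm (discr F L hL) : ℝ)

/-- The `i`-th successive minimum of `L` with respect to a region `B ⊆ A_∞`: the infimum of all
`r > 0` such that `L ∩ r B` contains `i` vectors that are linearly independent over `F`. -/
def succMin (F : Type*) {A : Type*} [Field F] [CommRing A] [Algebra F A]
    (L : Submodule (𝓞 F) A) (B : Set (Arch A)) (i : ℕ) : ℝ :=
  sInf {r : ℝ | 0 < r ∧ ∃ x : Fin i → A, LinearIndependent F x ∧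
    ∀ j, x j ∈ L ∧ diag A (x j) ∈ r • B}

/-! ### Regions with Lipschitz-parametrised boundary -/

/-- The half-open cube `[0,1)^m` in Euclidean space. -/
def cube (m : ℕ) : Set (EuclideanSpace ℝ (Fin m)) :=
  {x | ∀ i, 0 ≤ x i ∧ x i < 1}

/-- The map `φ`, restricted to `[0,1)^m`, is `(m, R)`-Lipschitz with respect to `B`. -/
def IsLip {A : Type*} [CommRing A] (B : Set (Arch A)) (m : ℕ) (R : ℝ)
    (φ : EuclideanSpace ℝ (Fin m) → Arch A) : Prop :=
  ∀ x ∈ cube m, ∀ y ∈ cube m, φ x - φ y ∈ (R * ‖x - y‖) • B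

/-- `T` is covered by the images of `N` maps that are `(m, R)`-Lipschitz with respect to `B`. -/
def InLip {A : Type*} [CommRing A] (B : Set (Arch A)) (m : ℕ) (R : ℝ) (N : ℕ)
    (T : Set (Arch A)) : Prop :=
  ∃ φ : Fin N → EuclideanSpace ℝ (Fin m) → Arch A,
    (∀ k, IsLip B m R (φ k)) ∧ T ⊆ ⋃ k, φ k '' cube m

end ArchLattice

end

/-!
The lattice `L` is compared with a sublattice of bounded index that has a well understood shape. Let
`x_1, …, x_n ∈ L` be linearly independent over `F` and attain the successive minima `λ_1, …, λ_n`
(`exists_isGreedy`, `succMin_eq_of_isGreedy`), and multiply them by an integral basis of `F`. As `τ`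
commutes with `F_∞`, the products have norm `≪ λ_i`, and every vector of `L` that involves a product
with `x_i` has norm at least `λ_i`: they form a *reduced frame* (`IsReducedFrame`,
`isReducedFrame_latticeFrame`).

For a reduced frame two facts follow from the pigeonhole principle alone, without Minkowski's second
theorem: the vectors of `L` are separated in the coordinates of the frame
(`IsReducedFrame.eq_zero_of_abs_repr_le`), and the coordinates satisfy `|x_i| ≪ ‖x‖ / λ_i`
(`IsReducedFrame.abs_repr_mul_le`). Hence a ball of radius `r` meets
`≪ ∏ (r / λ_i + 1)` translates, by vectors of `L`, of the parallelepiped of the frame. Cutting the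
parametrising cubes of the frontier of `S` into pieces bounds the number of translates that meet
the frontier (`IsReducedFrame.ncard_tiles_meeting_le`), and a suitable fineness gives the error term
(`exists_subdivision_le`).

That number bounds the error. The lattice has a fundamental domain inside the parallelepiped
(`exists_isAddFundamentalDomain_subset`), and a translate of it lies on one side of the frontier
whenever the translated parallelepiped, which is convex, misses the frontier
(`abs_ncard_sub_measure_div_le`).

It remains to see that the covolume of `L` is `|Δ_F|^{n/2} det_F L`. A pseudo-basis `L = ⨁ J_i f_i`
(`exists_pseudoBasis`) gives both the discriminant ideal (`discr_eq_of_pseudoBasis`) and a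
`ℤ`-basis of `L` with its discriminant over `ℚ` (`exists_int_generators`, by way of
`discr_smul_tower`), and the square of the covolume is the absolute value of this discriminant
(`sq_volume_fundamentalDomain_embedBasis`). The trace of an étale algebra is the sum over its complex
embeddings (`trace_eq_sum_algHom_of_etale`), which identifies the trace form of `A` with that of
`A_∞`.
-/

open Module

/-! ### Reduced frames of a lattice -/

/-- `b` is a real basis consisting of vectors of the lattice `Λ`, the `i`-th one of size at most
`M * lam i`, and every vector of `Λ` that involves `b i` has size at least `lam i`. This is what
vectors that realise successive minima `lam` of `Λ` with respect to `p` satisfy; `M` allows for the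
passage from such vectors over `F` to a `ℤ`-linearly independent family. The lattice spanned by `b`
may be a proper sublattice of `Λ`. -/
structure IsReducedFrame {E ι : Type*} [AddCommGroup E] [Module ℝ E] (p : Seminorm ℝ E)
    (Λ : Submodule ℤ E) (b : Basis ι ℝ E) (lam : ι → ℝ) (M : ℝ) : Prop where
  pos : ∀ i, 0 < lam i
  mem : ∀ i, b i ∈ Λ
  seminorm_le : ∀ i, p (b i) ≤ M * lam i
  le_seminorm : ∀ x ∈ Λ, ∀ i, b.repr x i ≠ 0 → lam i ≤ p x

/-- The number of parts into which a unit interval is cut in the pigeonhole arguments, in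
dimension `D`. Vectors of `Λ` whose coordinates in a reduced frame differ by less than the mesh
coincide, because the mesh is finer than `1 / (2 * D * M)`. -/
noncomputable def frameMesh (D : ℕ) (M : ℝ) : ℕ := ⌊2 * D * M⌋₊ + 2

/-- The bound for the coordinate of largest index in a reduced frame, twice the largest
denominator that simultaneous approximation needs. -/
noncomputable def frameBound (D : ℕ) (M : ℝ) : ℝ := 2 * (frameMesh D M : ℝ) ^ D

theorem frameMesh_pos (D : ℕ) (M : ℝ) : (0 : ℝ) < frameMesh D M := by
  unfold frameMesh; positivity

theorem lt_frameMesh (D : ℕ) (M : ℝ) : 2 * D * M < frameMesh D M := by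
  have := Nat.lt_floor_add_one (2 * D * M)
  unfold frameMesh; push_cast; linarith

theorem two_le_frameMesh (D : ℕ) (M : ℝ) : 2 ≤ frameMesh D M := Nat.le_add_left _ _

theorem frameBound_pos (D : ℕ) (M : ℝ) : 0 < frameBound D M := by
  have := frameMesh_pos D M
  unfold frameBound; positivity

/-- Dirichlet's theorem on simultaneous approximation. -/
theorem exists_simultaneous_approximation {ι : Type*} [Fintype ι] (w : ι → ℝ) {Q : ℕ}
    (hQ : 0 < Q) :
    ∃ q : ℕ, 0 < q ∧ q ≤ Q ^ Fintype.card ι ∧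
      ∃ z : ι → ℤ, ∀ i, |(q : ℝ) * w i - z i| ≤ 1 / Q := by
  classical
  have hQ' : (0 : ℝ) < Q := by exact_mod_cast hQ
  let f : ℕ → ι → ℕ := fun q i => ⌊(Q : ℝ) * Int.fract (q * w i)⌋₊
  have hf : ∀ q ∈ Finset.range (Q ^ Fintype.card ι + 1),
      f q ∈ Fintype.piFinset fun _ : ι => Finset.range Q := by
    intro q _
    rw [Fintype.mem_piFinset]
    intro i
    rw [Finset.mem_range, Nat.floor_lt (by have := Int.fract_nonneg ((q : ℝ) * w i); positivity)]
    have := Int.fract_lt_one ((q : ℝ) * w i)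
    nlinarith
  have key : ∀ q₁ q₂ : ℕ, q₁ < q₂ → q₂ ≤ Q ^ Fintype.card ι → f q₁ = f q₂ →
      ∃ q : ℕ, 0 < q ∧ q ≤ Q ^ Fintype.card ι ∧
      ∃ z : ι → ℤ, ∀ i, |(q : ℝ) * w i - z i| ≤ 1 / Q := by
    intro q₁ q₂ h1 h2 h
    refine ⟨q₂ - q₁, by omega, by omega, fun i => ⌊(q₂ : ℝ) * w i⌋ - ⌊(q₁ : ℝ) * w i⌋, fun i => ?_⟩
    have hi : ⌊(Q : ℝ) * Int.fract (q₁ * w i)⌋₊ = ⌊(Q : ℝ) * Int.fract (q₂ * w i)⌋₊ :=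
      congrFun h i
    have p1 := Int.fract_nonneg ((q₁ : ℝ) * w i)
    have p2 := Int.fract_nonneg ((q₂ : ℝ) * w i)
    have a1 := Nat.floor_le (a := (Q : ℝ) * Int.fract (q₁ * w i)) (by positivity)
    have a2 := Nat.lt_floor_add_one ((Q : ℝ) * Int.fract (q₁ * w i))
    have b1 := Nat.floor_le (a := (Q : ℝ) * Int.fract (q₂ * w i)) (by positivity)
    have b2 := Nat.lt_floor_add_one ((Q : ℝ) * Int.fract (q₂ * w i))
    rw [hi] at a1 a2
    have e : ((q₂ - q₁ : ℕ) : ℝ) * w i - ((⌊(q₂ : ℝ) * w i⌋ - ⌊(q₁ : ℝ) * w i⌋ : ℤ) : ℝ) =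
        Int.fract (q₂ * w i) - Int.fract (q₁ * w i) := by
      rw [Nat.cast_sub h1.le]; simp only [Int.fract]; push_cast; ring
    rw [e, abs_le]
    constructor
    · rw [neg_le, neg_sub, le_div_iff₀ hQ']; nlinarith
    · rw [le_div_iff₀ hQ']; nlinarith
  obtain ⟨q₁, h1, q₂, h2, hne, h⟩ := Finset.exists_ne_map_eq_of_card_lt_of_maps_to
    (by rw [Fintype.card_piFinset]; simp) hf
  rw [Finset.mem_range] at h1 h2
  rcases lt_or_gt_of_ne hne with hlt | hlt
  · exact key q₁ q₂ hlt (by omega) h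
  · exact key q₂ q₁ hlt (by omega) h.symm

section Frame

variable {E ι : Type*} [AddCommGroup E] [Module ℝ E] [Fintype ι] {p : Seminorm ℝ E}
  {Λ : Submodule ℤ E} {b : Basis ι ℝ E} {lam : ι → ℝ} {M : ℝ}

theorem Seminorm.le_sum_abs_repr (p : Seminorm ℝ E) (b : Basis ι ℝ E) (x : E) :
    p x ≤ ∑ i, |b.repr x i| * p (b i) := by
  conv_lhs => rw [← b.sum_repr x]
  refine (Finset.le_sum_of_subadditive p (map_zero p).le (map_add_le_add p) _ _).trans
    (Finset.sum_le_sum fun i _ => ?_)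
  rw [map_smul_eq_mul, Real.norm_eq_abs]

namespace IsReducedFrame

theorem seminorm_le_of_abs_repr_le (h : IsReducedFrame p Λ b lam M) (hM : 0 ≤ M) {x : E}
    {c ℓ : ℝ} (hc : 0 ≤ c) (hx : ∀ i, |b.repr x i| ≤ c) (hl : ∀ i, b.repr x i ≠ 0 → lam i ≤ ℓ)
    (hℓ : 0 ≤ ℓ) :
    p x ≤ Fintype.card ι * M * c * ℓ := by
  refine (p.le_sum_abs_repr b x).trans ?_
  have : ∀ i ∈ Finset.univ, |b.repr x i| * p (b i) ≤ M * c * ℓ := by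
    intro i _
    by_cases h0 : b.repr x i = 0
    · rw [h0]; simp; positivity
    · calc |b.repr x i| * p (b i) ≤ c * (M * ℓ) :=
            mul_le_mul (hx i) ((h.seminorm_le i).trans (mul_le_mul_of_nonneg_left (hl i h0) hM))
              (apply_nonneg p _) hc
        _ = M * c * ℓ := by ring
  refine (Finset.sum_le_sum this).trans ?_
  simp [Finset.card_univ, mul_assoc]

/-- The vectors of `Λ` are separated in the coordinates of the frame: if all coordinates of `x` are
small and `lam k` is largest among those that occur, then `p x < lam k`, against the lower bound. -/
theorem eq_zero_of_abs_repr_le (h : IsReducedFrame p Λ b lam M) (hM : 0 ≤ M) {x : E} (hx : x ∈ Λ)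
    (hs : ∀ i, |b.repr x i| ≤ 1 / frameMesh (Fintype.card ι) M) : x = 0 := by
  by_contra hne
  have hsupp : (b.repr x).support.Nonempty := by
    rw [Finsupp.support_nonempty_iff]; simpa using hne
  obtain ⟨k, hk, hmax⟩ := (b.repr x).support.exists_max_image lam hsupp
  rw [Finsupp.mem_support_iff] at hk
  have hQ := frameMesh_pos (Fintype.card ι) M
  have h1 := h.le_seminorm x hx k hk
  have h2 := h.seminorm_le_of_abs_repr_le hM (c := 1 / frameMesh (Fintype.card ι) M) (ℓ := lam k)
    (by positivity) hs (fun i hi => hmax i (by simpa using hi)) (h.pos k).le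
  have h3 := lt_frameMesh (Fintype.card ι) M
  have h4 : (Fintype.card ι : ℝ) * M * (1 / frameMesh (Fintype.card ι) M) ≤ 1 / 2 := by
    rw [mul_one_div, div_le_iff₀ hQ]; linarith
  have := h.pos k
  nlinarith

/-- A box of side lengths `ℓ` in the coordinates of the frame contains about `∏ i, (ℓ i + 1)`
lattice points. In particular the sublattice spanned by the frame has bounded index. -/
theorem ncard_box_le (h : IsReducedFrame p Λ b lam M) (hM : 0 ≤ M) (a ℓ : ι → ℝ)
    (hℓ : ∀ i, 0 ≤ ℓ i) :
    {x | x ∈ Λ ∧ ∀ i, b.repr x i ∈ Set.Icc (a i) (a i + ℓ i)}.Finite ∧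
    ({x | x ∈ Λ ∧ ∀ i, b.repr x i ∈ Set.Icc (a i) (a i + ℓ i)}.ncard : ℝ) ≤
      ∏ i, (frameMesh (Fintype.card ι) M * ℓ i + 1) := by
  classical
  set Q := frameMesh (Fintype.card ι) M with hQdef
  have hQ : (0 : ℝ) < Q := frameMesh_pos (Fintype.card ι) M
  set X := {x | x ∈ Λ ∧ ∀ i, b.repr x i ∈ Set.Icc (a i) (a i + ℓ i)} with hX
  let f : E → ι → ℕ := fun x i => ⌊(Q : ℝ) * (b.repr x i - a i)⌋₊
  let T : Finset (ι → ℕ) := Fintype.piFinset fun i => Finset.range (⌊(Q : ℝ) * ℓ i⌋₊ + 1)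
  have hmaps : Set.MapsTo f X T := by
    intro x hx
    rw [Finset.mem_coe, Fintype.mem_piFinset]
    intro i
    rw [Finset.mem_range, Nat.lt_succ_iff]
    exact Nat.floor_le_floor (mul_le_mul_of_nonneg_left (by linarith [(hx.2 i).2]) hQ.le)
  have hinj : Set.InjOn f X := by
    intro x hx y hy hxy
    rw [← sub_eq_zero]
    refine h.eq_zero_of_abs_repr_le hM (Λ.sub_mem hx.1 hy.1) fun i => ?_
    have hi : ⌊(Q : ℝ) * (b.repr x i - a i)⌋₊ = ⌊(Q : ℝ) * (b.repr y i - a i)⌋₊ := congrFun hxy i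
    have p1 : 0 ≤ b.repr x i - a i := by linarith [(hx.2 i).1]
    have p2 : 0 ≤ b.repr y i - a i := by linarith [(hy.2 i).1]
    have a1 := Nat.floor_le (a := (Q : ℝ) * (b.repr x i - a i)) (by positivity)
    have a2 := Nat.lt_floor_add_one ((Q : ℝ) * (b.repr x i - a i))
    have b1 := Nat.floor_le (a := (Q : ℝ) * (b.repr y i - a i)) (by positivity)
    have b2 := Nat.lt_floor_add_one ((Q : ℝ) * (b.repr y i - a i))
    rw [hi] at a1 a2
    rw [map_sub, Finsupp.sub_apply, abs_le]
    constructor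
    · rw [neg_le, neg_sub, le_div_iff₀ hQ]; nlinarith
    · rw [le_div_iff₀ hQ]; nlinarith
  refine ⟨Set.Finite.of_injOn hmaps hinj T.finite_toSet, ?_⟩
  have hcard : X.ncard ≤ T.card := by
    rw [← Set.ncard_coe_finset]
    exact Set.ncard_le_ncard_of_injOn f hmaps hinj T.finite_toSet
  calc (X.ncard : ℝ) ≤ T.card := by exact_mod_cast hcard
    _ = ∏ i, ((⌊(Q : ℝ) * ℓ i⌋₊ : ℝ) + 1) := by simp [T, Fintype.card_piFinset]
    _ ≤ ∏ i, ((Q : ℝ) * ℓ i + 1) := by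
      refine Finset.prod_le_prod (fun i _ => by positivity) fun i _ => ?_
      have := Nat.floor_le (a := (Q : ℝ) * ℓ i) (mul_nonneg hQ.le (hℓ i))
      linarith

/-- The coordinate at the largest minimum that occurs in `x` is bounded by the size of `x`: if `x`
were too close to the span of the other frame vectors, then rounding the coordinates of a suitable
multiple of `x` would give a lattice vector that involves `b k` and is shorter than `lam k`. -/
theorem abs_repr_top_le (h : IsReducedFrame p Λ b lam M) (hM : 0 ≤ M) (k : ι) {x : E}
    (hx : ∀ i, b.repr x i ≠ 0 → lam i ≤ lam k) :
    |b.repr x k| * lam k ≤ frameBound (Fintype.card ι) M * p x := by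
  by_cases h0 : b.repr x k = 0
  · rw [h0]; simp only [abs_zero, zero_mul]
    exact mul_nonneg (frameBound_pos _ _).le (apply_nonneg p x)
  set Q := frameMesh (Fintype.card ι) M with hQdef
  have hQ : (0 : ℝ) < Q := frameMesh_pos (Fintype.card ι) M
  obtain ⟨q, hq0, hqle, z, hz⟩ := exists_simultaneous_approximation
    (fun i => b.repr x i / b.repr x k) (Q := Q) (by exact_mod_cast hQ)
  -- the multiple of `x` with `k`-th coordinate `q` is close to the lattice point `y`
  let y : E := ∑ i, z i • b i
  have hyΛ : y ∈ Λ := Λ.sum_mem fun i _ => Λ.smul_mem _ (h.mem i)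
  have hyr : ∀ i, b.repr y i = z i := by
    intro i
    have : y = ∑ i, (z i : ℝ) • b i := by simp [y, Int.cast_smul_eq_zsmul]
    rw [this, b.repr_sum_self]
  have hQ2 : (1 : ℝ) / Q ≤ 1 / 2 := by
    have : (2 : ℝ) ≤ Q := by exact_mod_cast two_le_frameMesh (Fintype.card ι) M
    exact one_div_le_one_div_of_le (by norm_num) this
  have hq1 : (1 : ℝ) ≤ q := by exact_mod_cast hq0
  have hyk : b.repr y k ≠ 0 := by
    have := (abs_le.1 (hz k)).2
    rw [div_self h0] at this
    rw [hyr]; intro h00; linarith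
  let d : E := y - (q / b.repr x k) • x
  have hd : ∀ i, b.repr d i = z i - q * (b.repr x i / b.repr x k) := by
    intro i
    simp only [d, map_sub, map_smul, Finsupp.sub_apply, Finsupp.smul_apply, hyr, smul_eq_mul]
    ring
  have hpd : p d ≤ Fintype.card ι * M * (1 / Q) * lam k := by
    refine h.seminorm_le_of_abs_repr_le hM (by positivity) (fun i => ?_) (fun i hi => ?_)
      (h.pos k).le
    · rw [hd, abs_sub_comm]; exact hz i
    · refine hx i fun hxi => hi ?_
      have hzi := hz i
      rw [hd, hxi]
      rw [hxi, zero_div, mul_zero, zero_sub, abs_neg, ← Int.cast_abs] at hzi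
      have : |z i| < 1 := by
        have : ((|z i| : ℤ) : ℝ) < 1 := by linarith
        exact_mod_cast this
      rw [Int.abs_lt_one_iff.1 this]; simp
  have h3 := lt_frameMesh (Fintype.card ι) M
  have h4 : (Fintype.card ι : ℝ) * M * (1 / Q) ≤ 1 / 2 := by
    rw [mul_one_div, div_le_iff₀ hQ]; linarith
  have hk := h.pos k
  have hpy : p y ≤ p d + q / |b.repr x k| * p x := by
    have : y = d + (q / b.repr x k) • x := by simp [d]
    rw [this]
    refine (map_add_le_add p _ _).trans ?_
    rw [map_smul_eq_mul, Real.norm_eq_abs, abs_div, Nat.abs_cast]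
  have hlow := h.le_seminorm y hyΛ k hyk
  have ht : 0 < |b.repr x k| := abs_pos.2 h0
  have hfin : lam k / 2 ≤ q / |b.repr x k| * p x := by nlinarith
  rw [div_mul_eq_mul_div, le_div_iff₀ ht] at hfin
  have hqQ : (q : ℝ) ≤ (Q : ℝ) ^ Fintype.card ι := by exact_mod_cast hqle
  have hpx : 0 ≤ p x := apply_nonneg p x
  calc |b.repr x k| * lam k ≤ 2 * (q * p x) := by linarith
    _ ≤ 2 * ((Q : ℝ) ^ Fintype.card ι * p x) := by gcongr
    _ = _ := by rw [frameBound]; ring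

/-- All coordinates of `x` in a reduced frame are bounded by the size of `x`, by descent from the
largest minimum. The set `s` is the support of `x`. -/
theorem abs_repr_mul_le (h : IsReducedFrame p Λ b lam M) (hM : 0 ≤ M) (s : Finset ι) :
    ∀ x : E, (∀ i, b.repr x i ≠ 0 → i ∈ s) → ∀ i ∈ s, |b.repr x i| * lam i ≤
      frameBound (Fintype.card ι) M * (1 + M * frameBound (Fintype.card ι) M) ^ s.card * p x := by
  classical
  have hB := frameBound_pos (Fintype.card ι) M
  set B := frameBound (Fintype.card ι) M
  induction s using Finset.induction_on_max_value lam with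
  | empty => simp
  | insert a s ha hmax ih =>
    intro x hx
    have htop : |b.repr x a| * lam a ≤ B * p x := h.abs_repr_top_le hM a fun i hi => by
      rcases Finset.mem_insert.1 (hx i hi) with rfl | hi'
      · exact le_rfl
      · exact hmax i hi'
    have hone : 1 ≤ 1 + M * B := by have : 0 ≤ M * B := by positivity
                                    linarith
    have hpx : 0 ≤ p x := apply_nonneg p x
    intro i hi
    rw [Finset.card_insert_of_notMem ha]
    rcases Finset.mem_insert.1 hi with rfl | his
    · refine htop.trans ?_
      rw [mul_right_comm]
      exact le_mul_of_one_le_right (by positivity) (one_le_pow₀ hone)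
    · let y := x - b.repr x a • b a
      have hy : ∀ j, b.repr y j = if j = a then 0 else b.repr x j := by
        intro j
        simp only [y, map_sub, map_smul, Basis.repr_self, Finsupp.sub_apply, Finsupp.smul_apply,
          Finsupp.single_apply, smul_eq_mul]
        split_ifs with h1 h2 h2
        · subst h1; simp
        · exact absurd h1.symm h2
        · exact absurd h2.symm h1
        · simp
      have hia : i ≠ a := fun hh => ha (hh ▸ his)
      have hys := ih y (fun j hj => by
        rw [hy] at hj
        split_ifs at hj with hja
        · exact absurd rfl hj
        · exact (Finset.mem_insert.1 (hx j hj)).resolve_left hja) i his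
      rw [hy, if_neg hia] at hys
      have hpy : p y ≤ (1 + M * B) * p x := by
        calc p y ≤ p x + |b.repr x a| * p (b a) := by
              refine (map_sub_le_add p _ _).trans ?_
              rw [map_smul_eq_mul, Real.norm_eq_abs]
          _ ≤ p x + |b.repr x a| * (M * lam a) := by gcongr; exact h.seminorm_le a
          _ = p x + M * (|b.repr x a| * lam a) := by ring
          _ ≤ p x + M * (B * p x) := by gcongr
          _ = _ := by ring
      calc _ ≤ B * (1 + M * B) ^ s.card * p y := hys
        _ ≤ B * (1 + M * B) ^ s.card * ((1 + M * B) * p x) := by gcongr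
        _ = _ := by ring

end IsReducedFrame

end Frame

/-! ### Tiles that meet a Lipschitz image -/

namespace IsReducedFrame

/-- The constant `C` in the bound `|x_i| ≤ C * p x / lam i` for the coordinates of a vector `x` in
a reduced frame. -/
noncomputable def coordBound (D : ℕ) (M : ℝ) : ℝ :=
  frameBound D M * (1 + M * frameBound D M) ^ D

theorem coordBound_nonneg (D : ℕ) {M : ℝ} (hM : 0 ≤ M) : 0 ≤ coordBound D M := by
  have := frameBound_pos D M
  unfold coordBound; positivity

/-- The constant, per coordinate, in the bound for the number of tiles that meet a ball. -/
noncomputable def tileBound (D : ℕ) (M : ℝ) : ℝ :=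
  frameMesh D M * (2 * coordBound D M + 1) + 1

theorem tileBound_nonneg (D : ℕ) {M : ℝ} (hM : 0 ≤ M) : 0 ≤ tileBound D M := by
  have := coordBound_nonneg D hM
  have := frameMesh_pos D M
  unfold tileBound; positivity

variable {E ι : Type*} [NormedAddCommGroup E] [NormedSpace ℝ E] [Fintype ι] {p : Seminorm ℝ E}
  {Λ : Submodule ℤ E} {b : Basis ι ℝ E} {lam : ι → ℝ} {M : ℝ}

/-- The number of lattice translates of the frame parallelepiped that meet a ball of radius `r`. -/
theorem ncard_tiles_near_le (h : IsReducedFrame p Λ b lam M) (hM : 0 ≤ M) (y : E) {r : ℝ}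
    (hr : 0 ≤ r) :
    {x | x ∈ Λ ∧ ∃ z, p (z - y) ≤ r ∧ z - x ∈ ZSpan.fundamentalDomain b}.Finite ∧
    ({x | x ∈ Λ ∧ ∃ z, p (z - y) ≤ r ∧ z - x ∈ ZSpan.fundamentalDomain b}.ncard : ℝ) ≤
      ∏ i, (tileBound (Fintype.card ι) M * (r / lam i + 1)) := by
  set Q : ℝ := ((frameMesh (Fintype.card ι) M : ℕ) : ℝ) with hQdef
  have hQ : 0 < Q := frameMesh_pos (Fintype.card ι) M
  set C := coordBound (Fintype.card ι) M with hCdef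
  have hC : 0 ≤ C := coordBound_nonneg _ hM
  have hrl : ∀ i, 0 ≤ r / lam i := fun i => div_nonneg hr (h.pos i).le
  obtain ⟨hfin, hcard⟩ := h.ncard_box_le hM (fun i => b.repr y i - C * (r / lam i) - 1)
    (fun i => 2 * (C * (r / lam i)) + 1) (fun i => by have := hrl i; positivity)
  have hsub : {x | x ∈ Λ ∧ ∃ z, p (z - y) ≤ r ∧ z - x ∈ ZSpan.fundamentalDomain b} ⊆
      {x | x ∈ Λ ∧ ∀ i, b.repr x i ∈ Set.Icc (b.repr y i - C * (r / lam i) - 1)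
        (b.repr y i - C * (r / lam i) - 1 + (2 * (C * (r / lam i)) + 1))} := by
    rintro x ⟨hx, z, hz, hzx⟩
    refine ⟨hx, fun i => ?_⟩
    have h1 : |b.repr (z - y) i| ≤ C * (r / lam i) := by
      have := h.abs_repr_mul_le hM Finset.univ (z - y) (fun _ _ => Finset.mem_univ _) i
        (Finset.mem_univ _)
      rw [← mul_div_assoc, le_div_iff₀ (h.pos i)]
      exact this.trans (mul_le_mul_of_nonneg_left hz hC)
    have h2 := ZSpan.mem_fundamentalDomain b |>.1 hzx i
    rw [map_sub, Finsupp.sub_apply] at h1 h2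
    have h3 := abs_le.1 h1
    constructor <;> linarith [h2.1, h2.2, h3.1, h3.2]
  refine ⟨hfin.subset hsub, ?_⟩
  calc _ ≤ (({x | x ∈ Λ ∧ ∀ i, b.repr x i ∈ Set.Icc (b.repr y i - C * (r / lam i) - 1)
        (b.repr y i - C * (r / lam i) - 1 + (2 * (C * (r / lam i)) + 1))}.ncard : ℕ) : ℝ) := by
        exact_mod_cast Set.ncard_le_ncard hsub hfin
    _ ≤ ∏ i, (Q * (2 * (C * (r / lam i)) + 1) + 1) := hcard
    _ ≤ _ := by
      refine Finset.prod_le_prod (fun i _ => by have := hrl i; positivity) fun i _ => ?_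
      have := hrl i
      rw [tileBound, ← hQdef, ← hCdef]
      have : 0 ≤ Q * (r / lam i) := by positivity
      nlinarith

/-- The number of lattice translates of the frame parallelepiped that meet a set covered by `N`
Lipschitz images of a cube: cut the cube into `K ^ m` subcubes, whose images lie in balls. -/
theorem ncard_tiles_meeting_le (h : IsReducedFrame p Λ b lam M) (hM : 0 ≤ M) {m N : ℕ} {R : ℝ}
    (hR : 0 ≤ R) (φ : Fin N → EuclideanSpace ℝ (Fin m) → E)
    (hφ : ∀ k, ∀ x ∈ ArchLattice.cube m, ∀ y ∈ ArchLattice.cube m,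
      p (φ k x - φ k y) ≤ R * ‖x - y‖)
    {T : Set E} (hT : T ⊆ ⋃ k, φ k '' ArchLattice.cube m) {K : ℕ} (hK : 0 < K) :
    {x | x ∈ Λ ∧ ∃ z ∈ T, z - x ∈ ZSpan.fundamentalDomain b}.Finite ∧
    ({x | x ∈ Λ ∧ ∃ z ∈ T, z - x ∈ ZSpan.fundamentalDomain b}.ncard : ℝ) ≤
      N * (K ^ m * ∏ i, (tileBound (Fintype.card ι) M * (R * (m / K) / lam i + 1))) := by
  have hK' : (0 : ℝ) < K := by exact_mod_cast hK
  let corner : (Fin m → Fin K) → EuclideanSpace ℝ (Fin m) :=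
    fun a => WithLp.toLp 2 fun i => ((a i : ℕ) : ℝ) / K
  let Y : Fin N × (Fin m → Fin K) → Set E := fun ka =>
    {x | x ∈ Λ ∧ ∃ z, p (z - φ ka.1 (corner ka.2)) ≤ R * (m / K) ∧
      z - x ∈ ZSpan.fundamentalDomain b}
  have hY := fun ka : Fin N × (Fin m → Fin K) =>
    h.ncard_tiles_near_le hM (φ ka.1 (corner ka.2)) (r := R * (m / K)) (by positivity)
  -- the point `u` of the cube lies in the subcube whose corner has coordinates `⌊K * u i⌋ / K`
  have hsub : {x | x ∈ Λ ∧ ∃ z ∈ T, z - x ∈ ZSpan.fundamentalDomain b} ⊆ ⋃ ka, Y ka := by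
    rintro x ⟨hx, z, hz, hzx⟩
    obtain ⟨k, u, hu, rfl⟩ := Set.mem_iUnion.1 (hT hz)
    have hfl : ∀ i, ⌊(K : ℝ) * u i⌋₊ < K := fun i => by
      rw [Nat.floor_lt (mul_nonneg hK'.le (hu i).1)]
      nlinarith [(hu i).2]
    let a : Fin m → Fin K := fun i => ⟨⌊(K : ℝ) * u i⌋₊, hfl i⟩
    refine Set.mem_iUnion.2 ⟨(k, a), hx, φ k u, ?_, hzx⟩
    have hcor : corner a ∈ ArchLattice.cube m := fun i => by
      have : ((a i : ℕ) : ℝ) < K := by exact_mod_cast (a i).2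
      refine ⟨by simp only [corner]; positivity, ?_⟩
      simp only [corner]
      rwa [div_lt_one hK']
    refine (hφ k u hu _ hcor).trans (mul_le_mul_of_nonneg_left ?_ hR)
    have hcoord : ∀ i, ‖(u - corner a) i‖ ^ 2 ≤ (1 / K : ℝ) ^ 2 := fun i => by
      have h1 := Nat.floor_le (a := (K : ℝ) * u i) (mul_nonneg hK'.le (hu i).1)
      have h2 := Nat.lt_floor_add_one ((K : ℝ) * u i)
      have h3 : (u - corner a) i = u i - (⌊(K : ℝ) * u i⌋₊ : ℝ) / K := by simp [corner, a]
      rw [h3]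
      refine pow_le_pow_left₀ (norm_nonneg _) ?_ 2
      have h4 : (⌊(K : ℝ) * u i⌋₊ : ℝ) / K ≤ u i := by
        rw [div_le_iff₀ hK']; linarith
      have h5 : u i ≤ (⌊(K : ℝ) * u i⌋₊ : ℝ) / K + 1 / K := by
        rw [← add_div, le_div_iff₀ hK']; linarith
      rw [Real.norm_of_nonneg (by linarith)]
      linarith
    rw [EuclideanSpace.norm_eq]
    refine Real.sqrt_le_iff.2 ⟨by positivity, (Finset.sum_le_sum fun i _ => hcoord i).trans ?_⟩
    rw [Finset.sum_const, Finset.card_univ, Fintype.card_fin, nsmul_eq_mul, div_pow, div_pow,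
      one_pow, mul_one_div]
    gcongr
    have : m ≤ m ^ 2 := Nat.le_self_pow two_ne_zero m
    exact_mod_cast this
  have hUfin : (⋃ ka, Y ka).Finite := Set.finite_iUnion fun ka => (hY ka).1
  refine ⟨hUfin.subset hsub, ?_⟩
  calc _ ≤ (((⋃ ka, Y ka).ncard : ℕ) : ℝ) := by exact_mod_cast Set.ncard_le_ncard hsub hUfin
    _ ≤ ∑ ka, ((Y ka).ncard : ℝ) := by exact_mod_cast Set.ncard_iUnion_le_of_fintype Y
    _ ≤ ∑ _ka : Fin N × (Fin m → Fin K),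
        ∏ i, (tileBound (Fintype.card ι) M * (R * (m / K) / lam i + 1)) :=
      Finset.sum_le_sum fun ka _ => (hY ka).2
    _ = _ := by
      rw [Finset.sum_const, Finset.card_univ, Fintype.card_prod, Fintype.card_fun]
      simp [mul_assoc]

end IsReducedFrame

theorem ZSpan.measurable_floor {E ι : Type*} [NormedAddCommGroup E] [NormedSpace ℝ E]
    [MeasurableSpace E] [BorelSpace E] [Fintype ι] (b : Basis ι ℝ E) :
    Measurable fun x : E => (ZSpan.floor b x : E) := by
  have : FiniteDimensional ℝ E := b.finiteDimensional_of_finite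
  have : (fun x : E => (ZSpan.floor b x : E)) = fun x => ∑ i, (⌊b.repr x i⌋ : ℝ) • b i := by
    ext x; simp [ZSpan.floor, Int.cast_smul_eq_zsmul]
  rw [this]
  refine Finset.measurable_fun_sum _ fun i _ => Measurable.smul_const ?_ _
  have h1 : Measurable fun x : E => b.repr x i :=
    (LinearMap.continuous_of_finiteDimensional (b.coord i)).measurable
  exact (measurable_from_top (f := fun n : ℤ => (n : ℝ))).comp (Int.measurable_floor.comp h1)

open MeasureTheory in
/-- If the basis `b` spans a sublattice of the lattice with `ℤ`-basis `g`, then the larger lattice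
has a measurable fundamental domain inside the parallelepiped of `b`. -/
theorem exists_isAddFundamentalDomain_subset {E ι κ : Type*} [NormedAddCommGroup E]
    [NormedSpace ℝ E] [MeasurableSpace E] [BorelSpace E] [Finite ι] [Finite κ]
    (μ : Measure E) [μ.IsAddLeftInvariant] (g : Basis κ ℝ E) (b : Basis ι ℝ E)
    (hb : ∀ i, b i ∈ Submodule.span ℤ (Set.range g)) :
    ∃ D ⊆ ZSpan.fundamentalDomain b, MeasurableSet D ∧
      (∀ x : E, ∃! v : Submodule.span ℤ (Set.range g), (v : E) + x ∈ D) ∧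
      μ D = μ (ZSpan.fundamentalDomain g) := by
  have := Fintype.ofFinite ι
  have := Fintype.ofFinite κ
  have : FiniteDimensional ℝ E := b.finiteDimensional_of_finite
  have hsub : Submodule.span ℤ (Set.range b) ≤ Submodule.span ℤ (Set.range g) := by
    rw [Submodule.span_le]; rintro _ ⟨i, rfl⟩; exact hb i
  -- `f` is equivariant under the lattice of `g`, and `x - f x` lies in the parallelepiped of `b`
  let f : E → E := fun x => ZSpan.floor g x + ZSpan.floor b (ZSpan.fract g x)
  have hfr : Measurable fun x : E => ZSpan.fract g x := measurable_id.sub (ZSpan.measurable_floor g)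
  have hf : Measurable f := (ZSpan.measurable_floor g).add ((ZSpan.measurable_floor b).comp hfr)
  have hfmem : ∀ x, f x ∈ Submodule.span ℤ (Set.range g) := fun x =>
    Submodule.add_mem _ (ZSpan.floor g x).2 (hsub (ZSpan.floor b (ZSpan.fract g x)).2)
  have hfadd : ∀ v : Submodule.span ℤ (Set.range g), ∀ x, f (v + x) = v + f x := by
    intro v x
    have h1 : ZSpan.fract g (v + x) = ZSpan.fract g x := ZSpan.fract_zSpan_add g x v.2
    have h2 : (ZSpan.floor g (v + x) : E) = v + ZSpan.floor g x := by
      rw [ZSpan.fract_apply, ZSpan.fract_apply] at h1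
      have := congrArg (fun t => (v : E) + x - t) h1
      simp only [sub_sub_cancel] at this
      rw [this]; abel
    simp only [f, h1, h2, add_assoc]
  have hmeas : MeasurableSet {x | f x = 0} := measurableSet_eq_fun hf measurable_const
  have huniq : ∀ x : E, ∃! v : Submodule.span ℤ (Set.range g), (v : E) + x ∈ {x | f x = 0} := by
    intro x
    refine ⟨-⟨f x, hfmem x⟩, ?_, fun v hv => ?_⟩
    · simp only [Set.mem_ofPred_eq]; rw [hfadd]; simp
    · simp only [Set.mem_ofPred_eq] at hv
      rw [hfadd] at hv
      ext
      simpa using eq_neg_of_add_eq_zero_left hv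
  refine ⟨{x | f x = 0}, fun x hx => ?_, hmeas, huniq, ?_⟩
  · have hx' : (ZSpan.floor g x : E) = -(ZSpan.floor b (ZSpan.fract g x) : E) :=
      eq_neg_of_add_eq_zero_left hx
    have : x = ZSpan.fract b (ZSpan.fract g x) := by
      rw [ZSpan.fract_apply b, eq_sub_iff_add_eq]
      nth_rewrite 2 [ZSpan.fract_apply g]
      rw [hx', sub_neg_eq_add]
    rw [this]; exact ZSpan.fract_mem_fundamentalDomain b _
  · have : Countable (Submodule.span ℤ (Set.range g)) := inferInstance
    have : VAddInvariantMeasure (Submodule.span ℤ (Set.range g)) E μ :=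
      inferInstanceAs <| VAddInvariantMeasure (Submodule.span ℤ (Set.range g)).toAddSubgroup E μ
    have : MeasurableConstVAdd (Submodule.span ℤ (Set.range g)) E :=
      inferInstanceAs <| MeasurableConstVAdd (Submodule.span ℤ (Set.range g)).toAddSubgroup E
    exact IsAddFundamentalDomain.measure_eq
      (G := Submodule.span ℤ (Set.range g))
      (IsAddFundamentalDomain.mk' hmeas.nullMeasurableSet huniq)
      (ZSpan.isAddFundamentalDomain g μ)

/-! ### Counting lattice points by tiles -/

theorem IsPreconnected.exists_mem_frontier {X : Type*} [TopologicalSpace X] {P S : Set X}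
    (hP : IsPreconnected P) {x y : X} (hx : x ∈ P) (hxS : x ∈ S) (hy : y ∈ P) (hyS : y ∉ S) :
    ∃ z ∈ P, z ∈ frontier S := by
  by_contra! hcon
  have hsub : P ⊆ interior S ∪ interior Sᶜ := by
    rw [← compl_frontier_eq_union_interior]; exact hcon
  have hxi : x ∈ interior S := (hsub hx).resolve_right fun h => interior_subset h hxS
  have hyi : y ∈ interior Sᶜ := (hsub hy).resolve_left fun h => hyS (interior_subset h)
  obtain ⟨z, _, hz1, hz2⟩ := hP _ _ isOpen_interior isOpen_interior hsub ⟨x, hx, hxi⟩ ⟨y, hy, hyi⟩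
  exact interior_subset hz2 (interior_subset hz1)

theorem ZSpan.convex_fundamentalDomain {E ι : Type*} [NormedAddCommGroup E] [NormedSpace ℝ E]
    (b : Basis ι ℝ E) : Convex ℝ (ZSpan.fundamentalDomain b) := by
  have : ZSpan.fundamentalDomain b = ⋂ i, (b.coord i) ⁻¹' Set.Ico 0 1 := by
    ext; simp [ZSpan.fundamentalDomain]
  rw [this]
  exact convex_iInter fun i => (convex_Ico 0 1).linear_preimage (b.coord i)

open MeasureTheory in
/-- The number of points of the lattice of `g` in a bounded set `S` differs from the quotient of the
volumes by at most the number of translates of the parallelepiped of `b` that meet the frontier of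
`S`. The tiles compared with `S` are translates of a fundamental domain of the full lattice; only
their convex hulls, not the tiles themselves, are connected. No measurability of `S` is needed. -/
theorem abs_ncard_sub_measure_div_le {E ι κ : Type*} [NormedAddCommGroup E]
    [NormedSpace ℝ E] [MeasurableSpace E] [BorelSpace E] [Finite ι] [Finite κ]
    (μ : Measure E) [μ.IsAddHaarMeasure] (g : Basis κ ℝ E) (b : Basis ι ℝ E)
    (hb : ∀ i, b i ∈ Submodule.span ℤ (Set.range g)) {S : Set E} (hS : Bornology.IsBounded S)
    (hbad : {x | x ∈ Submodule.span ℤ (Set.range g) ∧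
      ∃ z ∈ frontier S, z - x ∈ ZSpan.fundamentalDomain b}.Finite) :
    {x | x ∈ Submodule.span ℤ (Set.range g) ∧ x ∈ S}.Finite ∧
    |({x | x ∈ Submodule.span ℤ (Set.range g) ∧ x ∈ S}.ncard : ℝ) -
        μ.real S / μ.real (ZSpan.fundamentalDomain g)| ≤
      {x | x ∈ Submodule.span ℤ (Set.range g) ∧
        ∃ z ∈ frontier S, z - x ∈ ZSpan.fundamentalDomain b}.ncard := by
  classical
  have : FiniteDimensional ℝ E := b.finiteDimensional_of_finite
  set Λ := Submodule.span ℤ (Set.range g) with hΛ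
  set Bad := {x | x ∈ Λ ∧ ∃ z ∈ frontier S, z - x ∈ ZSpan.fundamentalDomain b} with hBad
  set X := {x | x ∈ Λ ∧ x ∈ S} with hX
  obtain ⟨D, hDsub, hDm, hDu, hDμ⟩ := exists_isAddFundamentalDomain_subset μ g b hb
  have hXfin : X.Finite := (ZSpan.setFinite_inter g hS).subset fun x hx => ⟨hx.2, hx.1⟩
  refine ⟨hXfin, ?_⟩
  have hμ0 : 0 < μ.real D := by
    rw [measureReal_def, hDμ]
    exact ENNReal.toReal_pos (ZSpan.measure_fundamentalDomain_ne_zero g)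
      (ZSpan.fundamentalDomain_isBounded g).measure_lt_top.ne
  have hμtop : μ D ≠ ⊤ := by
    rw [hDμ]; exact (ZSpan.fundamentalDomain_isBounded g).measure_lt_top.ne
  -- the tile of a lattice point outside `Bad` lies on one side of the frontier
  have hside : ∀ x ∈ Λ, ∀ s, -x + s ∈ D → x ∉ Bad → (x ∈ S ↔ s ∈ S) := by
    intro x hx s hs hxb
    have hconv : IsPreconnected ((fun y => -x + y) ⁻¹' ZSpan.fundamentalDomain b) :=
      ((ZSpan.convex_fundamentalDomain b).translate_preimage_right (-x)).isPreconnected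
    have h1 : x ∈ (fun y => -x + y) ⁻¹' ZSpan.fundamentalDomain b := by
      simp
    have h2 : s ∈ (fun y => -x + y) ⁻¹' ZSpan.fundamentalDomain b := hDsub hs
    by_contra hcon
    have : ∃ z ∈ (fun y => -x + y) ⁻¹' ZSpan.fundamentalDomain b, z ∈ frontier S := by
      by_cases hxS : x ∈ S
      · exact hconv.exists_mem_frontier h1 hxS h2 fun hsS => hcon ⟨fun _ => hsS, fun _ => hxS⟩
      · exact hconv.exists_mem_frontier h2 (by tauto) h1 hxS
    obtain ⟨z, hz1, hz2⟩ := this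
    exact hxb ⟨hx, z, hz2, by rwa [Set.mem_preimage, neg_add_eq_sub] at hz1⟩
  have hmeas : ∀ I : Finset E, (∀ x ∈ I, x ∈ Λ) →
      μ (⋃ x ∈ I, (fun y => -x + y) ⁻¹' D) = I.card * μ D := by
    intro I hI
    rw [measure_biUnion_finset]
    · simp [measure_preimage_add]
    · intro x hx y hy hxy
      refine Set.disjoint_left.2 fun s hs1 hs2 => hxy ?_
      have := (hDu s).unique (y₁ := ⟨-x, Λ.neg_mem (hI x hx)⟩) (y₂ := ⟨-y, Λ.neg_mem (hI y hy)⟩)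
        hs1 hs2
      simpa using congrArg Subtype.val this
    · intro x _
      exact (measurable_const_add (-x)) hDm
  have hlow : (((X \ Bad).ncard : ℕ) : ℝ) * μ.real D ≤ μ.real S := by
    have hfin : (X \ Bad).Finite := hXfin.sdiff
    have h1 := hmeas hfin.toFinset fun x hx => ((hfin.mem_toFinset.1 hx).1).1
    rw [← Set.ncard_eq_toFinset_card _ hfin] at h1
    have h2 : ⋃ x ∈ hfin.toFinset, (fun y => -x + y) ⁻¹' D ⊆ S := by
      refine Set.iUnion₂_subset fun x hx s hs => ?_
      have hx' := hfin.mem_toFinset.1 hx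
      exact (hside x hx'.1.1 s hs hx'.2).1 hx'.1.2
    have h3 := measureReal_mono (μ := μ) h2 hS.measure_lt_top.ne
    rw [measureReal_def, h1] at h3
    simpa [measureReal_def] using h3
  have hup : μ.real S ≤ (((X ∪ Bad).ncard : ℕ) : ℝ) * μ.real D := by
    have hfin : (X ∪ Bad).Finite := hXfin.union hbad
    have h1 := hmeas hfin.toFinset fun x hx => by
      rcases hfin.mem_toFinset.1 hx with h | h
      exacts [h.1, h.1]
    rw [← Set.ncard_eq_toFinset_card _ hfin] at h1
    have h2 : S ⊆ ⋃ x ∈ hfin.toFinset, (fun y => -x + y) ⁻¹' D := by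
      intro s hs
      obtain ⟨v, hv, -⟩ := hDu s
      refine Set.mem_iUnion₂.2 ⟨-(v : E), ?_, by simpa using hv⟩
      rw [hfin.mem_toFinset]
      by_cases hvb : -(v : E) ∈ Bad
      · exact Or.inr hvb
      · exact Or.inl ⟨Λ.neg_mem v.2, (hside _ (Λ.neg_mem v.2) s (by simpa using hv) hvb).2 hs⟩
    have h3 := measureReal_mono (μ := μ) h2
      (by rw [h1]; exact ENNReal.mul_ne_top (ENNReal.natCast_ne_top _) hμtop)
    rw [measureReal_def, measureReal_def, h1] at h3
    simpa [measureReal_def] using h3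
  have hD : μ.real (ZSpan.fundamentalDomain g) = μ.real D := by
    rw [measureReal_def, measureReal_def, hDμ]
  have hc1 : (X.ncard : ℝ) ≤ (X \ Bad).ncard + Bad.ncard := by
    exact_mod_cast Set.ncard_le_ncard_sdiff_add_ncard X Bad hbad
  have hc2 : ((X ∪ Bad).ncard : ℝ) ≤ X.ncard + Bad.ncard := by
    exact_mod_cast Set.ncard_union_le X Bad
  rw [hD, abs_sub_le_iff]
  rw [← le_div_iff₀ hμ0] at hlow
  rw [← div_le_iff₀ hμ0] at hup
  constructor <;> linarith

/-! ### The size of the pieces of the frontier -/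

/-- The product is equal to the term of index `k` on the right, where `lam 1, …, lam k` are the values
that are at most `R`. -/
theorem prod_max_pow_le_sum (lam : ℕ → ℝ) (d : ℕ) {R : ℝ} (hR : 0 ≤ R) (n : ℕ)
    (hpos : ∀ i ∈ Finset.Icc 1 n, 0 < lam i)
    (hmono : ∀ i ∈ Finset.Icc 1 n, ∀ j ∈ Finset.Icc 1 n, i ≤ j → lam i ≤ lam j) :
    ∏ i ∈ Finset.Icc 1 n, max 1 (R / lam i) ^ d ≤
      ∑ i ∈ Finset.range (n + 1), R ^ (i * d) / (∏ j ∈ Finset.Icc 1 i, lam j) ^ d := by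
  have hterm : ∀ k ≤ n, 0 ≤ R ^ (k * d) / (∏ j ∈ Finset.Icc 1 k, lam j) ^ d := fun k hk =>
    div_nonneg (pow_nonneg hR _) (pow_nonneg (Finset.prod_nonneg fun j hj =>
      (hpos j (Finset.Icc_subset_Icc_right hk hj)).le) _)
  induction n with
  | zero => simp
  | succ n ih =>
    have hsub : Finset.Icc 1 n ⊆ Finset.Icc 1 (n + 1) := Finset.Icc_subset_Icc_right n.le_succ
    have hlast : n + 1 ∈ Finset.Icc 1 (n + 1) := by simp
    by_cases hc : lam (n + 1) ≤ R
    · have heq : ∏ i ∈ Finset.Icc 1 (n + 1), max 1 (R / lam i) ^ d =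
          R ^ ((n + 1) * d) / (∏ j ∈ Finset.Icc 1 (n + 1), lam j) ^ d := by
        rw [Finset.prod_pow, pow_mul, ← div_pow]
        congr 1
        have : ∀ i ∈ Finset.Icc 1 (n + 1), max 1 (R / lam i) = R / lam i := fun i hi =>
          max_eq_right ((one_le_div (hpos i hi)).2
            ((hmono i hi _ hlast (Finset.mem_Icc.1 hi).2).trans hc))
        rw [Finset.prod_congr rfl this, Finset.prod_div_distrib, Finset.prod_const]
        simp
      rw [heq]
      exact Finset.single_le_sum (f := fun i => R ^ (i * d) / (∏ j ∈ Finset.Icc 1 i, lam j) ^ d)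
        (fun k hk => hterm k (Nat.lt_succ_iff.1 (Finset.mem_range.1 hk))) (by simp)
    · rw [Finset.prod_Icc_succ_top (by omega), max_eq_left
        ((div_le_one (hpos _ hlast)).2 (not_le.1 hc).le), one_pow, mul_one, Finset.sum_range_succ]
      refine (ih (fun i hi => hpos i (hsub hi)) (fun i hi j hj => hmono i (hsub hi) j (hsub hj))
        fun k hk => hterm k (hk.trans n.le_succ)).trans ?_
      exact le_add_of_nonneg_right (hterm _ le_rfl)

/-- The optimal number `K` of subdivisions of the sides of the cube: no subdivision if `R ≤ lam n`,
and pieces of size about `lam n` otherwise. The two cases account for the two parts of the bound. -/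
theorem exists_subdivision_le (lam : ℕ → ℝ) {d n : ℕ} (hd : 1 ≤ d) (hn : 1 ≤ n) {R c : ℝ}
    (hR : 0 ≤ R) (hc : 0 ≤ c) (hpos : ∀ i ∈ Finset.Icc 1 n, 0 < lam i)
    (hmono : ∀ i ∈ Finset.Icc 1 n, ∀ j ∈ Finset.Icc 1 n, i ≤ j → lam i ≤ lam j) :
    ∃ K : ℕ, 0 < K ∧
      (K : ℝ) ^ (n * d - 1) * ∏ i ∈ Finset.Icc 1 n, (R * (c / K) / lam i + 1) ^ d ≤
        2 ^ (n * d - 1) * (c + 1) ^ (n * d) *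
          (R ^ (n * d - 1) / ((∏ j ∈ Finset.Icc 1 (n - 1), lam j) ^ d * lam n ^ (d - 1)) +
            ∑ i ∈ Finset.range n, R ^ (i * d) / (∏ j ∈ Finset.Icc 1 i, lam j) ^ d) := by
  obtain ⟨n, rfl⟩ : ∃ k, n = k + 1 := ⟨n - 1, by omega⟩
  obtain ⟨d, rfl⟩ : ∃ k, d = k + 1 := ⟨d - 1, by omega⟩
  have hlast : n + 1 ∈ Finset.Icc 1 (n + 1) := by simp
  have hsub : Finset.Icc 1 n ⊆ Finset.Icc 1 (n + 1) := Finset.Icc_subset_Icc_right n.le_succ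
  have hl := hpos _ hlast
  set m := (n + 1) * (d + 1) - 1 with hm
  have hm1 : (n + 1) * (d + 1) = m + 1 := by
    have : 0 < (n + 1) * (d + 1) := by positivity
    omega
  have hP : ∀ k ≤ n, 0 < ∏ j ∈ Finset.Icc 1 k, lam j := fun k hk =>
    Finset.prod_pos fun j hj => hpos j (Finset.Icc_subset_Icc_right (by omega) hj)
  have hterm : ∀ k ∈ Finset.range (n + 1),
      0 ≤ R ^ (k * (d + 1)) / (∏ j ∈ Finset.Icc 1 k, lam j) ^ (d + 1) := fun k hk => by
    have := hP k (by simpa [Nat.lt_succ_iff] using hk)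
    positivity
  have hfirst : 0 ≤ R ^ m / ((∏ j ∈ Finset.Icc 1 (n + 1 - 1), lam j) ^ (d + 1) *
      lam (n + 1) ^ (d + 1 - 1)) := by
    have := hP n le_rfl
    rw [Nat.add_sub_cancel]
    positivity
  have hcc : 1 ≤ c + 1 := by linarith
  have h2 : (1 : ℝ) ≤ 2 ^ m := one_le_pow₀ (by norm_num)
  rcases le_or_gt R (lam (n + 1)) with hRl | hRl
  · refine ⟨1, one_pos, ?_⟩
    rw [Nat.cast_one, one_pow, one_mul, div_one]
    have h1 : ∏ i ∈ Finset.Icc 1 (n + 1), (R * c / lam i + 1) ^ (d + 1) ≤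
        ∏ i ∈ Finset.Icc 1 (n + 1), ((c + 1) ^ (d + 1) * max 1 (R / lam i) ^ (d + 1)) := by
      refine Finset.prod_le_prod (fun i hi => by have := hpos i hi; positivity) fun i hi => ?_
      have := hpos i hi
      rw [← mul_pow]
      refine pow_le_pow_left₀ (by positivity) ?_ _
      have e1 : R / lam i ≤ max 1 (R / lam i) := le_max_right _ _
      have e2 : 1 ≤ max 1 (R / lam i) := le_max_left _ _
      rw [mul_comm R c, mul_div_assoc]
      nlinarith
    rw [Finset.prod_mul_distrib, Finset.prod_const, Nat.card_Icc, Nat.add_sub_cancel, ← pow_mul,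
      mul_comm (d + 1), hm1] at h1
    refine h1.trans ?_
    have h3 : ∏ i ∈ Finset.Icc 1 (n + 1), max 1 (R / lam i) ^ (d + 1) ≤
        ∑ i ∈ Finset.range (n + 1), R ^ (i * (d + 1)) / (∏ j ∈ Finset.Icc 1 i, lam j) ^ (d + 1) := by
      rw [Finset.prod_Icc_succ_top (by omega), max_eq_left ((div_le_one hl).2 hRl), one_pow, mul_one]
      exact prod_max_pow_le_sum lam (d + 1) hR n (fun i hi => hpos i (hsub hi))
        (fun i hi j hj => hmono i (hsub hi) j (hsub hj))
    have hs := Finset.sum_nonneg hterm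
    rw [hm1]
    calc (c + 1) ^ (m + 1) * ∏ i ∈ Finset.Icc 1 (n + 1), max 1 (R / lam i) ^ (d + 1)
        ≤ (c + 1) ^ (m + 1) * ∑ i ∈ Finset.range (n + 1),
          R ^ (i * (d + 1)) / (∏ j ∈ Finset.Icc 1 i, lam j) ^ (d + 1) := by gcongr
      _ ≤ 2 ^ m * (c + 1) ^ (m + 1) * ∑ i ∈ Finset.range (n + 1),
          R ^ (i * (d + 1)) / (∏ j ∈ Finset.Icc 1 i, lam j) ^ (d + 1) := by
        gcongr
        exact le_mul_of_one_le_left (by positivity) h2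
      _ ≤ _ := by
        gcongr
        exact le_add_of_nonneg_left hfirst
  · -- subdivide until the pieces have the size of the last minimum
    have hR0 : 0 < R := hl.trans hRl
    have hq : 1 < R / lam (n + 1) := (one_lt_div hl).2 hRl
    set K := ⌈R / lam (n + 1)⌉₊ with hK
    have hK0 : 0 < K := Nat.ceil_pos.2 (by linarith)
    have hK1 : R / lam (n + 1) ≤ K := Nat.le_ceil _
    have hK2 : (K : ℝ) ≤ 2 * (R / lam (n + 1)) := by
      have := (Nat.ceil_lt_add_one (a := R / lam (n + 1)) (by linarith)).le
      linarith
    have hK0' : (0 : ℝ) < K := by exact_mod_cast hK0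
    refine ⟨K, hK0, ?_⟩
    have h1 : ∏ i ∈ Finset.Icc 1 (n + 1), (R * (c / K) / lam i + 1) ^ (d + 1) ≤
        ∏ i ∈ Finset.Icc 1 (n + 1), ((c + 1) ^ (d + 1) * (lam (n + 1) / lam i) ^ (d + 1)) := by
      refine Finset.prod_le_prod (fun i hi => by have := hpos i hi; positivity) fun i hi => ?_
      have hi0 := hpos i hi
      rw [← mul_pow]
      refine pow_le_pow_left₀ (by positivity) ?_ _
      have e1 : 1 ≤ lam (n + 1) / lam i :=
        (one_le_div hi0).2 (hmono i hi _ hlast (Finset.mem_Icc.1 hi).2)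
      have e2 : R * (c / K) ≤ c * lam (n + 1) := by
        rw [← mul_div_assoc, div_le_iff₀ hK0']
        rw [div_le_iff₀ hl] at hK1
        nlinarith
      have e3 : R * (c / K) / lam i ≤ c * (lam (n + 1) / lam i) := by
        rw [← mul_div_assoc c]; exact div_le_div_of_nonneg_right e2 hi0.le
      linarith
    rw [Finset.prod_mul_distrib, Finset.prod_const, Nat.card_Icc, Nat.add_sub_cancel, ← pow_mul,
      mul_comm (d + 1), hm1, Finset.prod_pow _ _ fun i => lam (n + 1) / lam i,
      Finset.prod_div_distrib, Finset.prod_const,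
      Nat.card_Icc, Nat.add_sub_cancel, Finset.prod_Icc_succ_top (f := lam) (by omega)] at h1
    have hPn := hP n le_rfl
    have hs := Finset.sum_nonneg hterm
    rw [hm1]
    calc (K : ℝ) ^ m * ∏ i ∈ Finset.Icc 1 (n + 1), (R * (c / K) / lam i + 1) ^ (d + 1)
        ≤ (2 * (R / lam (n + 1))) ^ m * ((c + 1) ^ (m + 1) * (lam (n + 1) ^ (n + 1) /
            ((∏ j ∈ Finset.Icc 1 n, lam j) * lam (n + 1))) ^ (d + 1)) := by
          refine mul_le_mul (pow_le_pow_left₀ hK0'.le hK2 _) h1 ?_ (by positivity)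
          exact Finset.prod_nonneg fun i hi => by have := hpos i hi; positivity
      _ = 2 ^ m * (c + 1) ^ (m + 1) * (R ^ m / ((∏ j ∈ Finset.Icc 1 n, lam j) ^ (d + 1) *
            lam (n + 1) ^ d)) := by
          have e : (lam (n + 1) ^ (n + 1)) ^ (d + 1) = lam (n + 1) ^ m * lam (n + 1) := by
            rw [← pow_mul, hm1, pow_succ]
          rw [mul_pow, div_pow, div_pow, mul_pow, e, pow_succ (lam (n + 1)) d]
          field_simp
      _ ≤ _ := by
        rw [Nat.add_sub_cancel, Nat.add_sub_cancel]
        gcongr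
        exact le_add_of_nonneg_right hs

/-! ### Successive minima and greedy bases -/

section Greedy

variable {K V : Type*} [Field K] [AddCommGroup V] [Module K V]

/-- The vectors `x 0, x 1, …` of `L` are linearly independent, and each is of least weight among the
vectors of `L` outside the span of its predecessors. -/
structure IsGreedy (K : Type*) {V : Type*} [Field K] [AddCommGroup V] [Module K V] (L : Set V)
    (w : V → ℝ) {m : ℕ} (x : Fin m → V) : Prop where
  linearIndependent : LinearIndependent K x
  mem : ∀ i, x i ∈ L
  le : ∀ i, ∀ y ∈ L, y ∉ Submodule.span K (x '' {j | j < i}) → w (x i) ≤ w y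

theorem exists_isGreedy [FiniteDimensional K V] {L : Set V} {w : V → ℝ}
    (hL : Submodule.span K L = ⊤) (hfin : ∀ r : ℝ, {x | x ∈ L ∧ w x ≤ r}.Finite) {m : ℕ}
    (hm : m ≤ finrank K V) : ∃ x : Fin m → V, IsGreedy K L w x := by
  induction m with
  | zero =>
    exact ⟨Fin.elim0, linearIndependent_empty_type, fun i => i.elim0, fun i => i.elim0⟩
  | succ m ih =>
    obtain ⟨x, hx⟩ := ih (by omega)
    have hne : ∃ y ∈ L, y ∉ Submodule.span K (Set.range x) := by
      by_contra! hcon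
      have htop : Submodule.span K (Set.range x) = ⊤ := by
        rw [eq_top_iff, ← hL]; exact Submodule.span_le.2 hcon
      have h1 := finrank_range_le_card (R := K) x
      rw [Set.finrank, htop, finrank_top, Fintype.card_fin] at h1
      omega
    obtain ⟨y₀, hy₀, hy₀'⟩ := hne
    obtain ⟨y, ⟨⟨hyL, hy'⟩, hyle⟩, hymin⟩ := Set.exists_min_image
      {z | (z ∈ L ∧ z ∉ Submodule.span K (Set.range x)) ∧ w z ≤ w y₀} w
      ((hfin (w y₀)).subset fun z hz => ⟨hz.1.1, hz.2⟩) ⟨y₀, ⟨hy₀, hy₀'⟩, le_rfl⟩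
    refine ⟨Fin.snoc x y, linearIndependent_finSnoc.2 ⟨hx.linearIndependent, hy'⟩, fun i => ?_,
      fun i => ?_⟩
    · refine Fin.lastCases ?_ (fun i => ?_) i
      · simpa using hyL
      · simpa using hx.mem i
    · refine Fin.lastCases ?_ (fun i => ?_) i
      · intro z hz hz'
        have himg : (Fin.snoc x y : Fin (m + 1) → V) '' {j | j < Fin.last m} = Set.range x := by
          ext v
          constructor
          · rintro ⟨j, hj, rfl⟩
            refine ⟨j.castPred (ne_of_lt hj), ?_⟩
            rw [← Fin.snoc_castSucc (α := fun _ => V) y x (j.castPred (ne_of_lt hj)),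
              Fin.castSucc_castPred]
          · rintro ⟨j, rfl⟩
            exact ⟨j.castSucc, Fin.castSucc_lt_last j, Fin.snoc_castSucc (α := fun _ => V) _ _ _⟩
        rw [himg] at hz'
        rw [Fin.snoc_last]
        rcases le_or_gt (w z) (w y₀) with h | h
        · exact hymin z ⟨⟨hz, hz'⟩, h⟩
        · exact hyle.trans h.le
      · intro z hz hz'
        rw [Fin.snoc_castSucc]
        refine hx.le i z hz fun hmem => hz' (Submodule.span_mono ?_ hmem)
        rintro _ ⟨j, hj, rfl⟩
        exact ⟨j.castSucc, by simpa using hj, Fin.snoc_castSucc (α := fun _ => V) _ _ _⟩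

namespace IsGreedy

variable {L : Set V} {w : V → ℝ} {m : ℕ} {x : Fin m → V}

theorem monotone (h : IsGreedy K L w x) {i j : Fin m} (hij : i ≤ j) : w (x i) ≤ w (x j) :=
  h.le i _ (h.mem j) (h.linearIndependent.notMem_span_image (by simpa using hij))

/-- Greedily chosen vectors attain the successive minima. -/
theorem isLeast (h : IsGreedy K L w x) (hw : ∀ y ∈ L, y ≠ 0 → 0 < w y) (i : Fin m) :
    IsLeast {r : ℝ | 0 < r ∧ ∃ y : Fin (i + 1) → V, LinearIndependent K y ∧
      ∀ j, y j ∈ L ∧ w (y j) ≤ r} (w (x i)) := by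
  constructor
  · refine ⟨hw _ (h.mem i) (h.linearIndependent.ne_zero i), fun j => x (Fin.castLE i.2 j),
      h.linearIndependent.comp _ (Fin.castLE_injective i.2), fun j => ⟨h.mem _, h.monotone ?_⟩⟩
    rw [Fin.le_def, Fin.val_castLE]
    exact Nat.lt_succ_iff.1 j.2
  · rintro r ⟨-, y, hy, hyr⟩
    by_contra! hlt
    have hmem : ∀ j, y j ∈ Submodule.span K (x '' {j | j < i}) := fun j => by
      by_contra hj
      exact absurd ((h.le i _ (hyr j).1 hj).trans (hyr j).2) (not_le.2 hlt)
    have h1 : Set.finrank K (Set.range y) ≤ Set.finrank K (x '' {j | j < i}) := by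
      have : FiniteDimensional K (Submodule.span K (x '' {j | j < i})) :=
        FiniteDimensional.span_of_finite K (Set.toFinite _)
      exact Submodule.finrank_mono (Submodule.span_le.2 (by rintro _ ⟨j, rfl⟩; exact hmem j))
    have h2 : Set.finrank K (Set.range y) = i + 1 := by
      rw [Set.finrank, finrank_span_eq_card hy, Fintype.card_fin]
    have h3 : Set.finrank K (x '' {j | j < i}) ≤ i := by
      classical
      have : x '' {j | j < i} = ((Finset.univ.filter (· < i)).image x : Set V) := by
        ext; simp
      rw [this]
      refine (finrank_span_finset_le_card _).trans (Finset.card_image_le.trans ?_)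
      rw [Finset.filter_gt_eq_Iio, Fin.card_Iio]
    omega

theorem le_of_repr_ne_zero {b : Basis (Fin m) K V} (h : IsGreedy K L w b) {y : V} (hy : y ∈ L)
    {i : Fin m} (hi : b.repr y i ≠ 0) : w (b i) ≤ w y := by
  refine h.le i y hy fun hmem => ?_
  rw [b.mem_span_image] at hmem
  exact lt_irrefl i (hmem (Finsupp.mem_support_iff.2 hi))

end IsGreedy

end Greedy

/-! ### Étale algebras over algebraically closed fields -/

open scoped TensorProduct

theorem Algebra.trace_fun_apply {K X : Type*} [Field K] [Fintype X] (f : X → K) :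
    Algebra.trace K (X → K) f = ∑ i, f i := by
  classical
  rw [Algebra.trace_eq_matrix_trace (Pi.basisFun K X), Matrix.trace]
  refine Finset.sum_congr rfl fun i _ => ?_
  rw [Matrix.diag_apply, Algebra.leftMulMatrix_eq_repr_mul]
  simp

theorem Algebra.trace_baseChange_tmul {k Ω A : Type*} [Field k] [Field Ω] [Algebra k Ω]
    [CommRing A] [Algebra k A] [Module.Finite k A] (a : A) :
    Algebra.trace Ω (Ω ⊗[k] A) (1 ⊗ₜ a) = algebraMap k Ω (Algebra.trace k A a) := by
  rw [Algebra.trace_apply, Algebra.trace_apply, ← LinearMap.trace_baseChange]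
  congr 1
  ext x
  simp

section Etale

variable (k Ω A : Type*) [Field k] [Field Ω] [IsAlgClosed Ω] [Algebra k Ω]
  [CommRing A] [Algebra k A] [Module.Finite k A] [Algebra.Etale k A]

/-- After base change to an algebraically closed field `Ω`, an étale algebra becomes a product of
copies of `Ω`, one for each homomorphism to `Ω`. -/
theorem exists_equiv_algHom_of_etale :
    ∃ (_ : Fintype (PrimeSpectrum (Ω ⊗[k] A)))
      (e : Ω ⊗[k] A ≃ₐ[Ω] (PrimeSpectrum (Ω ⊗[k] A) → Ω))
      (ev : PrimeSpectrum (Ω ⊗[k] A) ≃ (A →ₐ[k] Ω)), ∀ p a, ev p a = e (1 ⊗ₜ a) p := by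
  classical
  let B := Ω ⊗[k] A
  let X := PrimeSpectrum B
  let e : B ≃ₐ[Ω] (X → Ω) := Algebra.FormallyEtale.equivPiOfIsSepClosed Ω B
  have : IsArtinianRing B := IsArtinianRing.of_finite Ω B
  let _ := Fintype.ofFinite X
  let ev : X → (A →ₐ[k] Ω) := fun p =>
    (((Pi.evalAlgHom Ω (fun _ => Ω) p).comp e.toAlgHom).restrictScalars k).comp
      Algebra.TensorProduct.includeRight
  have hinj : Function.Injective ev := by
    intro p q h
    have h1 : (Pi.evalAlgHom Ω (fun _ : X => Ω) p).comp e.toAlgHom =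
        (Pi.evalAlgHom Ω (fun _ : X => Ω) q).comp e.toAlgHom := by
      refine Algebra.TensorProduct.ext (by ext) h
    by_contra hpq
    have h2 := DFunLike.congr_fun h1 (e.symm (Pi.single p 1))
    simp [hpq] at h2
  have hcard : Nat.card (A →ₐ[k] Ω) ≤ Nat.card X := by
    refine (card_algHom_le_finrank k A Ω).trans ?_
    rw [← Module.finrank_baseChange (R := Ω), e.toLinearEquiv.finrank_eq]
    simp
  have hbij : Function.Bijective ev := hinj.bijective_of_nat_card_le hcard
  exact ⟨inferInstance, e, Equiv.ofBijective ev hbij, fun p a => rfl⟩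

theorem card_algHom_of_etale : Nat.card (A →ₐ[k] Ω) = finrank k A := by
  obtain ⟨_, e, ev, -⟩ := exists_equiv_algHom_of_etale k Ω A
  rw [← Nat.card_congr ev, ← Module.finrank_baseChange (R := Ω), e.toLinearEquiv.finrank_eq]
  simp

theorem trace_eq_sum_algHom_of_etale [Fintype (A →ₐ[k] Ω)] (a : A) :
    algebraMap k Ω (Algebra.trace k A a) = ∑ σ : A →ₐ[k] Ω, σ a := by
  obtain ⟨_, e, ev, hev⟩ := exists_equiv_algHom_of_etale k Ω A
  rw [← Algebra.trace_baseChange_tmul, ← Algebra.trace_eq_of_algEquiv e, Algebra.trace_fun_apply,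
    ← ev.sum_comp]
  exact Finset.sum_congr rfl fun p _ => (hev p a).symm

end Etale

/-! ### Étale algebras over the rational numbers -/

theorem eq_zero_of_forall_algHom_eq_zero (k Ω : Type*) {A : Type*} [Field k] [Field Ω]
    [IsAlgClosed Ω] [Algebra k Ω] [CommRing A] [Algebra k A] [Module.Finite k A] [Algebra.Etale k A]
    {x : A} (hx : ∀ σ : A →ₐ[k] Ω, σ x = 0) : x = 0 := by
  obtain ⟨_, e, ev, hev⟩ := exists_equiv_algHom_of_etale k Ω A
  have h1 : e (1 ⊗ₜ x) = 0 := by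
    ext p; rw [← hev, hx]; rfl
  have h2 : (1 : Ω) ⊗ₜ[k] x = 0 := (map_eq_zero_iff e e.injective).1 h1
  have hinj : Function.Injective (Algebra.TensorProduct.includeRight : A →ₐ[k] Ω ⊗[k] A) :=
    Algebra.TensorProduct.includeRight_injective (algebraMap k Ω).injective
  exact hinj (by simpa using h2)

section Rat

variable (A : Type*) [CommRing A] [Algebra ℚ A] [Module.Finite ℚ A] [Algebra.Etale ℚ A]

theorem card_ringHom_complex : Nat.card (A →+* ℂ) = finrank ℚ A := by
  rw [Nat.card_congr (RingHom.equivRatAlgHom A ℂ), card_algHom_of_etale]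

theorem trace_eq_sum_ringHom_complex [Fintype (A →+* ℂ)] (a : A) :
    ((Algebra.trace ℚ A a : ℚ) : ℂ) = ∑ σ : A →+* ℂ, σ a := by
  have := Fintype.ofFinite (A →ₐ[ℚ] ℂ)
  have h := trace_eq_sum_algHom_of_etale ℚ ℂ A a
  rw [eq_ratCast] at h
  rw [h]
  exact (Fintype.sum_equiv (RingHom.equivRatAlgHom A ℂ) _ _ fun σ => rfl).symm

variable {A}

theorem discr_ne_zero_of_etale {ι : Type*} [Fintype ι] [DecidableEq ι] (a : Basis ι ℚ A) :
    Algebra.discr ℚ a ≠ 0 := by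
  have : Fintype (A →ₐ[ℚ] ℂ) := Fintype.ofFinite _
  rw [Algebra.discr_def]
  intro hdet
  obtain ⟨c, hc, hc0⟩ := Matrix.exists_mulVec_eq_zero_iff.2 hdet
  set x : A := ∑ k, c k • a k with hx
  have htr : ∀ y, Algebra.trace ℚ A (y * x) = 0 := by
    have hlin : (Algebra.trace ℚ A).comp (LinearMap.mulRight ℚ x) = 0 := by
      refine a.ext fun l => ?_
      have h := congrFun hc0 l
      simp only [Matrix.mulVec, dotProduct, Algebra.traceMatrix_apply, Algebra.traceForm_apply,
        Pi.zero_apply] at h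
      rw [LinearMap.comp_apply, LinearMap.mulRight_apply, hx, Finset.mul_sum, map_sum,
        LinearMap.zero_apply, ← h]
      refine Finset.sum_congr rfl fun k _ => ?_
      rw [mul_smul_comm, map_smul, smul_eq_mul, mul_comm]
    exact fun y => LinearMap.congr_fun hlin y
  have hσ : ∀ σ : A →ₐ[ℚ] ℂ, σ x = 0 := by
    have hind := linearIndependent_toLinearMap ℚ A ℂ
    refine Fintype.linearIndependent_iff.1 hind (fun σ => σ x) ?_
    ext y
    have h := trace_eq_sum_algHom_of_etale ℚ ℂ A (y * x)
    rw [htr, map_zero] at h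
    simp only [LinearMap.sum_apply, LinearMap.smul_apply, AlgHom.toLinearMap_apply, smul_eq_mul,
      LinearMap.zero_apply]
    rw [h]
    exact Finset.sum_congr rfl fun σ _ => by rw [map_mul, mul_comm]
  have hx0 := eq_zero_of_forall_algHom_eq_zero ℚ ℂ hσ
  exact hc (funext fun k => Fintype.linearIndependent_iff.1 a.linearIndependent c hx0 k)

end Rat

/-! ### Pseudo-bases over Dedekind domains -/

section PseudoBasis

variable {R K V : Type*} [CommRing R] [IsDedekindDomain R] [Field K] [Algebra R K]
  [IsFractionRing R K] [AddCommGroup V] [Module K V] [Module R V] [IsScalarTower R K V]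

/-- The functional `φ` maps `L` onto the invertible ideal `J`, hence the map `L → J` splits: `v`
is `∑ b_k • l_k`, where `1 = ∑ φ(l_k) b_k` with `l_k ∈ L` and `b_k ∈ J⁻¹`. -/
theorem exists_smul_mem_of_functional (L : Submodule R V) (φ : V →ₗ[K] K)
    (J : (FractionalIdeal R⁰ K)ˣ)
    (hJ : ∀ c : K, c ∈ (J : FractionalIdeal R⁰ K) ↔ ∃ l ∈ L, φ l = c) :
    ∃ v : V, φ v = 1 ∧ ∀ c ∈ (J : FractionalIdeal R⁰ K), c • v ∈ L := by
  have hone : (1 : K) ∈ ((J : FractionalIdeal R⁰ K) * (J⁻¹ : (FractionalIdeal R⁰ K)ˣ) :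
      FractionalIdeal R⁰ K) := by
    rw [Units.mul_inv]; exact FractionalIdeal.one_mem_one _
  rw [← FractionalIdeal.mem_coe, FractionalIdeal.coe_mul] at hone
  refine Submodule.mul_induction_on (C := fun t => ∃ v : V, φ v = t ∧
    ∀ c ∈ (J : FractionalIdeal R⁰ K), c • v ∈ L) hone ?_ ?_
  · intro a ha b hb
    obtain ⟨l, hl, rfl⟩ := (hJ a).1 ha
    refine ⟨b • l, by rw [map_smul, smul_eq_mul, mul_comm], fun c hc => ?_⟩
    have hcb : c * b ∈ ((J : FractionalIdeal R⁰ K) * (J⁻¹ : (FractionalIdeal R⁰ K)ˣ) :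
      FractionalIdeal R⁰ K) := FractionalIdeal.mul_mem_mul hc hb
    rw [Units.mul_inv, FractionalIdeal.mem_one_iff] at hcb
    obtain ⟨r, hr⟩ := hcb
    rw [smul_smul, ← hr, algebraMap_smul]
    exact L.smul_mem r hl
  · rintro s t ⟨v, rfl, hv⟩ ⟨u, rfl, hu⟩
    refine ⟨v + u, map_add _ _ _, fun c hc => ?_⟩
    rw [smul_add]
    exact L.add_mem (hv c hc) (hu c hc)

/-- Induction over the rank, splitting off the image of a functional. -/
theorem exists_pseudoBasis_aux [FiniteDimensional K V] (d : ℕ) : ∀ L : Submodule R V, L.FG →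
    finrank K (Submodule.span K (L : Set V)) ≤ d →
    ∃ (m : ℕ) (f : Fin m → V) (J : Fin m → (FractionalIdeal R⁰ K)ˣ), LinearIndependent K f ∧
      ∀ x, x ∈ L ↔ ∃ c : Fin m → K, (∀ i, c i ∈ (J i : FractionalIdeal R⁰ K)) ∧
        x = ∑ i, c i • f i := by
  have hzero : ∃ (m : ℕ) (f : Fin m → V) (J : Fin m → (FractionalIdeal R⁰ K)ˣ),
      LinearIndependent K f ∧
      ∀ x, x ∈ (⊥ : Submodule R V) ↔ ∃ c : Fin m → K,
        (∀ i, c i ∈ (J i : FractionalIdeal R⁰ K)) ∧ x = ∑ i, c i • f i :=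
    ⟨0, Fin.elim0, Fin.elim0, linearIndependent_empty_type, fun x => by simp⟩
  induction d with
  | zero =>
    intro L _ hd
    have : L = ⊥ := by
      have h1 := Submodule.finrank_eq_zero.1 (Nat.le_zero.1 hd)
      rw [eq_bot_iff]
      intro x hx
      have : x ∈ Submodule.span K (L : Set V) := Submodule.subset_span hx
      rw [h1] at this
      simpa using this
    rw [this]; exact hzero
  | succ d ih =>
    intro L hL hd
    by_cases hbot : L = ⊥
    · rw [hbot]; exact hzero
    obtain ⟨x₀, hx₀, hne⟩ := L.ne_bot_iff.1 hbot
    obtain ⟨φ, hφ⟩ : ∃ φ : V →ₗ[K] K, φ x₀ ≠ 0 := by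
      by_contra! hcon
      exact hne ((Module.forall_dual_apply_eq_zero_iff K x₀).1 hcon)
    let J₀ : FractionalIdeal R⁰ K := ⟨L.map (φ.restrictScalars R),
      FractionalIdeal.isFractional_of_fg (hL.map _)⟩
    have hJ₀ : ∀ c : K, c ∈ J₀ ↔ ∃ l ∈ L, φ l = c := fun c => Iff.rfl
    have hJne : J₀ ≠ 0 := by
      intro h0
      have : φ x₀ ∈ J₀ := (hJ₀ _).2 ⟨x₀, hx₀, rfl⟩
      rw [h0, FractionalIdeal.mem_zero_iff] at this
      exact hφ this
    obtain ⟨v, hv1, hvL⟩ := exists_smul_mem_of_functional L φ (Units.mk0 J₀ hJne) hJ₀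
    let L₀ : Submodule R V := L ⊓ (LinearMap.ker φ).restrictScalars R
    have : IsNoetherian R L := isNoetherian_of_fg_of_noetherian L hL
    have hL₀ : L₀.FG := by
      have : IsNoetherian R L₀ := isNoetherian_of_le (t := L) inf_le_left
      exact Module.Finite.iff_fg.1 inferInstance
    have hlt : Submodule.span K (L₀ : Set V) < Submodule.span K (L : Set V) := by
      refine lt_of_le_of_ne (Submodule.span_mono inf_le_left) fun heq => hφ ?_
      have h1 : x₀ ∈ Submodule.span K (L₀ : Set V) := heq ▸ Submodule.subset_span hx₀
      have h2 : Submodule.span K (L₀ : Set V) ≤ LinearMap.ker φ :=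
        Submodule.span_le.2 fun y hy => hy.2
      exact h2 h1
    obtain ⟨m, f, J, hf, hfL⟩ := ih L₀ hL₀ (by
      have := Submodule.finrank_lt_finrank_of_lt hlt; omega)
    have hfker : ∀ i, φ (f i) = 0 := by
      intro i
      obtain ⟨c, hc, hc0⟩ : ∃ c ∈ (J i : FractionalIdeal R⁰ K), c ≠ 0 := by
        by_contra! hcon
        exact (J i).ne_zero (FractionalIdeal.eq_zero_iff.2 hcon)
      have hmem : c • f i ∈ L₀ := by
        refine (hfL _).2 ⟨Pi.single i c, fun j => ?_, ?_⟩
        · by_cases hji : j = i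
          · subst hji; simpa using hc
          · rw [Pi.single_eq_of_ne hji]; exact (J j : FractionalIdeal R⁰ K).coeToSubmodule.zero_mem
        · simp [Pi.single_apply]
      have h0 : φ (c • f i) = 0 := hmem.2
      rw [map_smul, smul_eq_mul] at h0
      exact (mul_eq_zero.1 h0).resolve_left hc0
    have hφsum : ∀ c : Fin m → K, φ (∑ i, c i • f i) = 0 := fun c => by simp [hfker]
    refine ⟨m + 1, Fin.cons v f, Fin.cons (Units.mk0 J₀ hJne) J, ?_, fun x => ⟨fun hx => ?_, ?_⟩⟩
    · refine linearIndependent_finCons.2 ⟨hf, fun hmem => ?_⟩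
      have h2 : Submodule.span K (Set.range f) ≤ LinearMap.ker φ :=
        Submodule.span_le.2 (by rintro _ ⟨i, rfl⟩; exact hfker i)
      have : φ v = 0 := h2 hmem
      rw [hv1] at this
      exact one_ne_zero this
    · have hφx : φ x ∈ J₀ := (hJ₀ _).2 ⟨x, hx, rfl⟩
      have h0 : x - φ x • v ∈ L₀ :=
        ⟨L.sub_mem hx (hvL _ hφx), by simp [hv1]⟩
      obtain ⟨c, hc, hxc⟩ := (hfL _).1 h0
      refine ⟨Fin.cons (φ x) c, fun i => ?_, ?_⟩
      · refine Fin.cases ?_ (fun i => ?_) i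
        · simpa using hφx
        · simpa using hc i
      · rw [Fin.sum_univ_succ]
        simp only [Fin.cons_zero, Fin.cons_succ]
        rw [← hxc]; abel
    · rintro ⟨c, hc, rfl⟩
      rw [Fin.sum_univ_succ]
      simp only [Fin.cons_zero, Fin.cons_succ]
      refine L.add_mem (hvL _ (by simpa using hc 0)) ?_
      exact ((hfL _).2 ⟨fun i => c i.succ, fun i => by simpa using hc i.succ, rfl⟩).1

/-- A lattice over a Dedekind domain has a pseudo-basis: it is `⨁ J_i f_i` for a basis `f` of the
ambient space and fractional ideals `J_i`. -/
theorem exists_pseudoBasis [FiniteDimensional K V] {L : Submodule R V} (hL : L.FG)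
    (hspan : Submodule.span K (L : Set V) = ⊤) :
    ∃ (f : Basis (Fin (finrank K V)) K V) (J : Fin (finrank K V) → (FractionalIdeal R⁰ K)ˣ),
      ∀ x, x ∈ L ↔ ∀ i, f.repr x i ∈ (J i : FractionalIdeal R⁰ K) := by
  obtain ⟨m, f, J, hf, hfL⟩ := exists_pseudoBasis_aux (K := K) _ L hL le_rfl
  have htop : ⊤ ≤ Submodule.span K (Set.range f) := by
    rw [← hspan, Submodule.span_le]
    intro x hx
    obtain ⟨c, -, rfl⟩ := (hfL x).1 hx
    exact Submodule.sum_mem _ fun i _ => Submodule.smul_mem _ _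
      (Submodule.subset_span (Set.mem_range_self i))
  let b := Basis.mk hf htop
  obtain rfl : m = finrank K V := by rw [finrank_eq_card_basis b, Fintype.card_fin]
  refine ⟨b, J, fun x => ⟨fun hx => ?_, fun hx => (hfL x).2 ⟨fun i => b.repr x i, hx, ?_⟩⟩⟩
  · obtain ⟨c, hc, rfl⟩ := (hfL x).1 hx
    intro i
    have : ∑ i, c i • f i = ∑ i, c i • b i := by simp [b]
    rw [this, b.repr_sum_self]
    exact hc i
  · conv_lhs => rw [← b.sum_repr x]
    simp [b]

end PseudoBasis

/-! ### Discriminants of lattices -/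

theorem coe_fractionalIdeal_prod {R K ι : Type*} [CommRing R] [Field K] [Algebra R K] [Fintype ι]
    (J : ι → FractionalIdeal R⁰ K) :
    ((∏ i, J i : FractionalIdeal R⁰ K) : Submodule R K) =
      Submodule.span R (∏ i, ((J i : Submodule R K) : Set K)) := by
  rw [← Submodule.prod_span]
  simp only [Submodule.span_eq]
  exact map_prod (FractionalIdeal.coeSubmoduleHom R⁰ K) J Finset.univ

theorem det_mem_prod {R K ι : Type*} [CommRing R] [Field K] [Algebra R K] [Fintype ι]
    [DecidableEq ι] (J : ι → FractionalIdeal R⁰ K) (X : Matrix ι ι K) (hX : ∀ i k, X i k ∈ J k) :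
    X.det ∈ ((∏ i, J i : FractionalIdeal R⁰ K) : Submodule R K) := by
  rw [coe_fractionalIdeal_prod, Matrix.det_apply]
  refine Submodule.sum_mem _ fun σ _ => ?_
  have : ∏ i, X (σ i) i ∈ Submodule.span R (∏ i, ((J i : Submodule R K) : Set K)) :=
    Submodule.subset_span ((Set.mem_fintype_prod _ _).2 ⟨fun i => X (σ i) i, fun i => hX _ _, rfl⟩)
  rcases Int.units_eq_one_or (Equiv.Perm.sign σ) with h1 | h1
  · simpa [h1] using this
  · simpa [h1] using this

namespace ArchLattice

variable {F A : Type*} [Field F] [NumberField F] [CommRing A] [Algebra F A]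

/-- The discriminant of `⨁ J_i f_i` is `(∏ J_i)²` times the discriminant of `f`. -/
theorem discr_eq_of_pseudoBasis {L : Submodule (𝓞 F) A} (hL : L.FG)
    (f : Basis (Fin (finrank F A)) F A) (J : Fin (finrank F A) → (FractionalIdeal (𝓞 F)⁰ F)ˣ)
    (hJ : ∀ x, x ∈ L ↔ ∀ i, f.repr x i ∈ (J i : FractionalIdeal (𝓞 F)⁰ F)) :
    discr F L hL = FractionalIdeal.spanSingleton (𝓞 F)⁰ (Algebra.discr F f) *
      (∏ i, (J i : FractionalIdeal (𝓞 F)⁰ F)) ^ 2 := by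
  have hdet : ∀ x y : Fin (finrank F A) → A,
      (Matrix.of fun i j => Algebra.trace F A (x i * y j)).det =
        Algebra.discr F f * ((Matrix.of fun i k => f.repr (x i) k).det *
          (Matrix.of fun i k => f.repr (y i) k).det) := by
    intro x y
    have : (Matrix.of fun i j => Algebra.trace F A (x i * y j)) =
        (Matrix.of fun i k => f.repr (x i) k) * Algebra.traceMatrix F f *
          (Matrix.of fun i k => f.repr (y i) k).transpose := by
      ext i j
      rw [Matrix.of_apply]
      conv_lhs => rw [← f.sum_repr (x i), ← f.sum_repr (y j)]
      simp only [Matrix.mul_apply, Finset.sum_mul, Finset.mul_sum, map_sum, Matrix.of_apply,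
        Algebra.traceMatrix_apply, Algebra.traceForm_apply, Matrix.transpose_apply]
      refine Finset.sum_congr rfl fun k _ => Finset.sum_congr rfl fun l _ => ?_
      rw [smul_mul_smul_comm, map_smul, smul_eq_mul]
      ring
    rw [this, Matrix.det_mul, Matrix.det_mul, Matrix.det_transpose, Algebra.discr_def]
    ring
  apply FractionalIdeal.coeToSubmodule_injective
  beta_reduce
  rw [FractionalIdeal.coe_mul, FractionalIdeal.coe_spanSingleton, pow_two, FractionalIdeal.coe_mul]
  change Submodule.span (𝓞 F) (pairingDets F L) = _
  refine le_antisymm (Submodule.span_le.2 ?_) ?_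
  · rintro t ⟨x, y, hx, hy, rfl⟩
    rw [hdet]
    refine Submodule.mul_mem_mul (Submodule.mem_span_singleton_self _) (Submodule.mul_mem_mul ?_ ?_)
    · exact det_mem_prod _ _ fun i k => (hJ _).1 (hx i) k
    · exact det_mem_prod _ _ fun i k => (hJ _).1 (hy i) k
  · rw [coe_fractionalIdeal_prod, Submodule.span_mul_span, Submodule.span_mul_span]
    refine Submodule.span_mono ?_
    rintro _ ⟨_, rfl, _, ⟨s, hs, t, ht, rfl⟩, rfl⟩
    obtain ⟨c, hc, rfl⟩ := (Set.mem_fintype_prod _ _).1 hs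
    obtain ⟨c', hc', rfl⟩ := (Set.mem_fintype_prod _ _).1 ht
    have hmem : ∀ c : Fin (finrank F A) → F,
        (∀ i, c i ∈ ((J i : FractionalIdeal (𝓞 F)⁰ F) : Submodule (𝓞 F) F)) →
        ∀ i, c i • f i ∈ L := by
      intro c hc i
      rw [hJ]
      intro k
      rw [map_smul, Basis.repr_self, Finsupp.smul_single, Finsupp.single_apply]
      split_ifs with hik
      · subst hik; simpa using hc i
      · exact (J k : FractionalIdeal (𝓞 F)⁰ F).coeToSubmodule.zero_mem
    have hdiag : ∀ c : Fin (finrank F A) → F,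
        (Matrix.of fun i k => f.repr (c i • f i) k).det = ∏ i, c i := by
      intro c
      have : (Matrix.of fun i k => f.repr (c i • f i) k) = Matrix.diagonal c := by
        ext i k
        rw [Matrix.of_apply, map_smul, Basis.repr_self, Finsupp.smul_single, Finsupp.single_apply,
          Matrix.diagonal_apply]
        simp
      rw [this, Matrix.det_diagonal]
    refine ⟨fun i => c i • f i, fun i => c' i • f i, hmem c hc, hmem c' hc', ?_⟩
    rw [hdet, hdiag, hdiag]

theorem sq_latticeDet {L : Submodule (𝓞 F) A} (hL : L.FG)
    (f : Basis (Fin (finrank F A)) F A) (J : Fin (finrank F A) → (FractionalIdeal (𝓞 F)⁰ F)ˣ)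
    (hJ : ∀ x, x ∈ L ↔ ∀ i, f.repr x i ∈ (J i : FractionalIdeal (𝓞 F)⁰ F)) :
    latticeDet F L hL ^ 2 = |(Algebra.norm ℚ (Algebra.discr F f) : ℝ)| *
      (∏ i, (FractionalIdeal.absNorm (J i : FractionalIdeal (𝓞 F)⁰ F) : ℝ)) ^ 2 := by
  rw [latticeDet, Real.sq_sqrt (by exact_mod_cast FractionalIdeal.absNorm_nonneg _),
    discr_eq_of_pseudoBasis hL f J hJ, map_mul, map_pow, map_prod,
    FractionalIdeal.absNorm_span_singleton]
  push_cast
  rfl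

end ArchLattice

/-- The discriminant of the products of a basis of `F` over `ℚ` and a family in `A`. The trace matrix
factors into copies of the trace matrix of `ω` and the matrix over `ℚ` of the `F`-linear map given
by the trace matrix of `f`; the determinant of the latter is a norm. -/
theorem discr_smul_tower {F A κ ι : Type*} [Field F] [NumberField F] [CommRing A] [Algebra F A]
    [Module.Finite F A] [Algebra ℚ A] [IsScalarTower ℚ F A] [Fintype κ] [DecidableEq κ] [Fintype ι]
    [DecidableEq ι] (ω : Basis κ ℚ F) (f : ι → A) :
    (Algebra.discr ℚ fun p : ι × κ => ω p.2 • f p.1) =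
      Algebra.discr ℚ ω ^ Fintype.card ι * Algebra.norm ℚ (Algebra.discr F f) := by
  let T := Algebra.traceMatrix F f
  let g : (ι → F) →ₗ[F] (ι → F) := Matrix.toLin' T
  let b : Basis (ι × κ) ℚ (ι → F) := (Pi.basis fun _ : ι => ω).reindex (Equiv.sigmaEquivProd ι κ)
  have hb : ∀ p, b p = Pi.single p.1 (ω p.2) := fun p => by simp [b]
  have hmat : Algebra.traceMatrix ℚ (fun p : ι × κ => ω p.2 • f p.1) =
      Matrix.kroneckerMap (· * ·) (1 : Matrix ι ι ℚ) (Algebra.traceMatrix ℚ ω) *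
        LinearMap.toMatrix b b (g.restrictScalars ℚ) := by
    ext p q
    obtain ⟨i, j⟩ := p
    obtain ⟨i', j'⟩ := q
    have hrep : ∀ (v : ι → F) (k : ι) (l : κ), b.repr v (k, l) = ω.repr (v k) l := by
      intro v k l
      simp [b, Pi.basis_repr]
    rw [Matrix.mul_apply, Fintype.sum_prod_type, Finset.sum_eq_single i]
    · simp only [LinearMap.toMatrix_apply, hrep, hb, LinearMap.restrictScalars_apply, g,
        Matrix.kroneckerMap_apply, Matrix.one_apply_eq, one_mul, Algebra.traceMatrix_apply,
        Algebra.traceForm_apply, Matrix.toLin'_apply, Matrix.mulVec_single, T]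
      rw [← Algebra.trace_trace (S := F), smul_mul_smul_comm, map_smul]
      have ht : (MulOpposite.op (ω j') • (Algebra.traceMatrix F f).col i') i =
          Algebra.trace F A (f i * f i') * ω j' := rfl
      rw [ht]
      have hsum := ω.sum_repr (Algebra.trace F A (f i * f i') * ω j')
      calc Algebra.trace ℚ F ((ω j * ω j') • Algebra.trace F A (f i * f i'))
          = Algebra.trace ℚ F (ω j * (Algebra.trace F A (f i * f i') * ω j')) := by
            rw [smul_eq_mul]; congr 1; ring
        _ = _ := by
            conv_lhs => rw [← hsum]
            rw [Finset.mul_sum, map_sum]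
            refine Finset.sum_congr rfl fun x _ => ?_
            rw [mul_smul_comm, map_smul, smul_eq_mul, mul_comm]
    · intro k _ hk
      simp [Matrix.one_apply_ne hk.symm]
    · simp
  rw [Algebra.discr_def, hmat, Matrix.det_mul, Matrix.det_kronecker, Matrix.det_one, one_pow,
    one_mul,
    LinearMap.det_toMatrix, LinearMap.det_restrictScalars, LinearMap.det_toLin', Algebra.discr_def,
    Algebra.discr_def]

/-! ### Integral bases of lattices -/

namespace ArchLattice

variable {F A : Type*} [Field F] [NumberField F] [CommRing A] [Algebra F A]

/-- The `ℤ`-basis of a lattice `⨁ J_i f_i` formed by the products of `f_i` with a `ℤ`-basis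
of `J_i`, and its discriminant over `ℚ`. -/
theorem exists_int_generators [Module.Finite F A] [Algebra ℚ A] [IsScalarTower ℚ F A]
    {L : Submodule (𝓞 F) A} (hL : IsLattice F L) :
    ∃ a : Fin (finrank F A) × Free.ChooseBasisIndex ℤ (𝓞 F) → A,
      (∀ x, x ∈ Submodule.span ℤ (Set.range a) ↔ x ∈ L) ∧
      Submodule.span ℚ (Set.range a) = ⊤ ∧
      |(Algebra.discr ℚ a : ℝ)| =
        |(NumberField.discr F : ℝ)| ^ finrank F A * latticeDet F L hL.1 ^ 2 := by
  classical
  obtain ⟨f, J, hJ⟩ := exists_pseudoBasis (K := F) hL.1 hL.2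
  let κ := Free.ChooseBasisIndex ℤ (𝓞 F)
  let ω : Basis κ ℚ F := NumberField.integralBasis F
  have hcard : ∀ i, Fintype.card κ =
      Fintype.card (Free.ChooseBasisIndex ℤ (J i : FractionalIdeal (𝓞 F)⁰ F)) := fun i => by
    rw [← finrank_eq_card_chooseBasisIndex, ← finrank_eq_card_chooseBasisIndex,
      NumberField.fractionalIdeal_rank]
  let e := fun i => Fintype.equivOfCardEq (hcard i)
  let β : Fin (finrank F A) → Basis κ ℚ F := fun i =>
    (NumberField.basisOfFractionalIdeal F (J i)).reindex (e i).symm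
  have hβ : ∀ i c, c ∈ Submodule.span ℤ (Set.range (β i)) ↔
      c ∈ (J i : FractionalIdeal (𝓞 F)⁰ F) := fun i c => by
    rw [Basis.range_reindex]
    exact NumberField.mem_span_basisOfFractionalIdeal F
  let a : Fin (finrank F A) × κ → A := fun p => β p.1 p.2 • f p.1
  refine ⟨a, fun x => ⟨fun hx => ?_, fun hx => ?_⟩, ?_, ?_⟩
  · have hle : Submodule.span ℤ (Set.range a) ≤ L.restrictScalars ℤ := by
      rw [Submodule.span_le]
      rintro _ ⟨⟨i, j⟩, rfl⟩
      refine (hJ _).2 fun k => ?_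
      simp only [a]
      rw [map_smul, Basis.repr_self, Finsupp.smul_single, Finsupp.single_apply]
      split_ifs with hik
      · subst hik
        rw [smul_eq_mul, mul_one]
        exact (hβ i _).1 (Submodule.subset_span (Set.mem_range_self j))
      · exact (J k : FractionalIdeal (𝓞 F)⁰ F).coeToSubmodule.zero_mem
    exact hle hx
  · rw [← f.sum_repr x]
    refine Submodule.sum_mem _ fun i _ => ?_
    have hc := (hβ i _).2 ((hJ x).1 hx i)
    have hmap := Submodule.mem_map_of_mem
      (f := (LinearMap.toSpanSingleton F A (f i)).restrictScalars ℤ)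
      hc
    rw [Submodule.map_span] at hmap
    refine Submodule.span_mono ?_ hmap
    rintro _ ⟨_, ⟨j, rfl⟩, rfl⟩
    exact ⟨(i, j), rfl⟩
  · rw [eq_top_iff]
    intro x _
    rw [← f.sum_repr x]
    refine Submodule.sum_mem _ fun i _ => ?_
    have hc : f.repr x i ∈ Submodule.span ℚ (Set.range (β i)) := by
      rw [(β i).span_eq]; exact Submodule.mem_top
    have hmap := Submodule.mem_map_of_mem
      (f := (LinearMap.toSpanSingleton F A (f i)).restrictScalars ℚ)
      hc
    rw [Submodule.map_span] at hmap
    refine Submodule.span_mono ?_ hmap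
    rintro _ ⟨_, ⟨j, rfl⟩, rfl⟩
    exact ⟨(i, j), rfl⟩
  · let P : Matrix (Fin (finrank F A) × κ) (Fin (finrank F A) × κ) ℚ :=
      (Matrix.blockDiagonal fun i => ω.toMatrix (β i)).submatrix (Equiv.prodComm _ _)
        (Equiv.prodComm _ _)
    have ha : a = Matrix.vecMul (fun p : Fin (finrank F A) × κ => ω p.2 • f p.1)
        (P.map (algebraMap ℚ A)) := by
      ext ⟨i, j⟩
      simp only [a, Matrix.vecMul, dotProduct, Matrix.map_apply, P, Matrix.submatrix_apply,
        Equiv.prodComm_apply, Prod.swap_prod_mk, Matrix.blockDiagonal_apply]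
      rw [Fintype.sum_prod_type, Finset.sum_eq_single i]
      · conv_lhs => rw [← ω.sum_repr (β i j)]
        rw [Finset.sum_smul]
        refine Finset.sum_congr rfl fun k _ => ?_
        simp only [Prod.swap_prod_mk, if_true]
        rw [Basis.toMatrix_apply, mul_comm, ← Algebra.smul_def, smul_assoc]
      · intro k _ hk
        simp [hk]
      · simp
    have hPdet : |P.det| = ∏ i, FractionalIdeal.absNorm (J i : FractionalIdeal (𝓞 F)⁰ F) := by
      rw [Matrix.det_submatrix_equiv_self, Matrix.det_blockDiagonal, Finset.abs_prod]
      refine Finset.prod_congr rfl fun i _ => ?_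
      rw [← NumberField.det_basisOfFractionalIdeal_eq_absNorm F (J i) (e i), Basis.det_apply]
    rw [ha, Algebra.discr_of_matrix_vecMul, discr_smul_tower, sq_latticeDet hL.1 f J hJ,
      Fintype.card_fin, ← NumberField.coe_discr]
    rw [← Rat.cast_abs, abs_mul, abs_pow, hPdet, abs_mul, abs_pow]
    push_cast
    ring

end ArchLattice

/-! ### Coordinates on the archimedean completion -/

noncomputable section

namespace ArchLattice

variable (A : Type*) [CommRing A]

/-- The real places. -/
abbrev RealPlace := {w : Place A // w.IsReal}
/-- The complex places. -/
abbrev ComplexPlace := {w : Place A // ¬ w.IsReal}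
/-- The space `∏_{w real} ℝ × ∏_{w complex} ℂ` of coordinates on `A_∞`. -/
abbrev CoordSpace := (RealPlace A → ℝ) × (ComplexPlace A → ℂ)

variable {A}

/-- The place of a ring homomorphism `A → ℂ`. -/
def placeOf (σ : A →+* ℂ) : Place A := Quotient.mk (placeSetoid A) σ

theorem conjHom_conjHom (σ : A →+* ℂ) : conjHom (conjHom σ) = σ := by
  ext x; simp [conjHom]

theorem mk_conjHom (σ : A →+* ℂ) :
    placeOf (conjHom σ) = placeOf σ :=
  Quotient.sound (Or.inr (conjHom_conjHom σ).symm)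

theorem mk_hom (w : Place A) : placeOf w.hom = w := Quotient.out_eq w

theorem eq_hom_or_eq_conjHom (σ : A →+* ℂ) :
    σ = Place.hom (placeOf σ) ∨
      σ = conjHom (Place.hom (placeOf σ)) :=
  Quotient.exact (mk_hom (placeOf σ))

/-- The map `coords` as a linear map. -/
def coordsLinear : Arch A →ₗ[ℝ] CoordSpace A where
  toFun := coords A
  map_add' x y := by ext <;> simp [coords]
  map_smul' r x := by ext <;> simp [coords]

theorem coords_injective : Function.Injective (coordsLinear (A := A)) := by
  rw [← LinearMap.ker_eq_bot, LinearMap.ker_eq_bot']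
  intro x hx
  have hhom : ∀ w : Place A, x.1 w.hom = 0 := by
    intro w
    by_cases hw : w.IsReal
    · have h1 : (x.1 w.hom).re = 0 := congrFun (congrArg Prod.fst hx) ⟨w, hw⟩
      have h2 := x.2 w.hom
      rw [hw] at h2
      refine Complex.ext h1 ?_
      have := congrArg Complex.im h2
      simp only [Complex.conj_im] at this
      simp only [Complex.zero_im]
      linarith
    · exact congrFun (congrArg Prod.snd hx) ⟨w, hw⟩
  ext σ
  rcases eq_hom_or_eq_conjHom σ with h | h
  · rw [h]; simpa using hhom _
  · rw [h, x.2, hhom]; simp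

theorem coords_surjective : Function.Surjective (coordsLinear (A := A)) := by
  classical
  rintro ⟨u, z⟩
  -- prescribe the value `val w` at the chosen representative of `w`, and its conjugate at the other
  let val : Place A → ℂ := fun w => if h : w.IsReal then (u ⟨w, h⟩ : ℂ) else z ⟨w, h⟩
  let y : (A →+* ℂ) → ℂ := fun σ => if σ = Place.hom (placeOf σ)
    then val (placeOf σ)
    else starRingEnd ℂ (val (placeOf σ))
  have hy : ∀ σ, y (conjHom σ) = starRingEnd ℂ (y σ) := by
    intro σ
    simp only [y, mk_conjHom]
    set w : Place A := placeOf σ with hw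
    by_cases h1 : σ = w.hom
    · rw [if_pos h1]
      by_cases hr : w.IsReal
      · rw [if_pos (by rw [h1]; exact hr)]
        simp [val, hr]
      · rw [if_neg (by rw [h1]; exact hr)]
    · have h2 : σ = conjHom w.hom := (eq_hom_or_eq_conjHom σ).resolve_left h1
      have h3 : conjHom σ = w.hom := by rw [h2, conjHom_conjHom]
      rw [if_neg h1, if_pos h3, Complex.conj_conj]
  have hyhom : ∀ w : Place A, y w.hom = val w := by
    intro w
    simp only [y, mk_hom]
    simp
  refine ⟨⟨y, hy⟩, ?_⟩
  refine Prod.ext (funext fun w => ?_) (funext fun w => ?_)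
  · change (y w.1.hom).re = u w
    rw [hyhom]; simp [val, w.2]
  · change y w.1.hom = z w
    rw [hyhom]; simp [val, w.2]

/-- The map `coords` as a linear equivalence. -/
def coordsEquiv : Arch A ≃ₗ[ℝ] CoordSpace A :=
  LinearEquiv.ofBijective coordsLinear ⟨coords_injective, coords_surjective⟩

theorem sum_ringHom_eq_sum_place [Fintype (A →+* ℂ)] [Fintype (RealPlace A)]
    [Fintype (ComplexPlace A)] (f : (A →+* ℂ) → ℂ) :
    ∑ σ, f σ = ∑ w : RealPlace A, f w.1.hom +
      ∑ w : ComplexPlace A, (f w.1.hom + f (conjHom w.1.hom)) := by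
  classical
  have : Fintype (Place A) := inferInstanceAs (Fintype (Quotient (placeSetoid A)))
  have hfib : ∀ w : Place A, (∑ σ with placeOf σ = w, f σ) =
      if w.IsReal then f w.hom else f w.hom + f (conjHom w.hom) := by
    intro w
    have hset : (Finset.univ.filter fun σ : A →+* ℂ => placeOf σ = w) =
        {w.hom, conjHom w.hom} := by
      ext σ
      simp only [Finset.mem_filter, Finset.mem_univ, true_and, Finset.mem_insert,
        Finset.mem_singleton]
      constructor
      · rintro rfl; exact eq_hom_or_eq_conjHom σ
      · rintro (h | h)
        · rw [h, mk_hom]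
        · rw [h, mk_conjHom, mk_hom]
    rw [hset]
    split_ifs with hw
    · rw [hw]; simp
    · exact Finset.sum_pair fun h => hw h.symm
  rw [← Finset.sum_fiberwise Finset.univ (fun σ => placeOf σ) f]
  refine (Finset.sum_congr rfl fun w _ => (by convert hfib w)).trans ?_
  rw [← Fintype.sum_subtype_add_sum_subtype (fun w : Place A => w.IsReal)]
  congr 1
  · exact Finset.sum_congr (by ext; simp) fun w _ => if_pos w.2
  · exact Finset.sum_congr (by ext; simp) fun w _ => if_neg w.2

section Form

variable [Fintype (RealPlace A)] [Fintype (ComplexPlace A)]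

/-- The trace form of `A_∞` over `ℝ` in coordinates. A complex place contributes the trace
`2 Re(z z')` from `ℂ` to `ℝ`. -/
def traceFormCoord : LinearMap.BilinForm ℝ (CoordSpace A) :=
  LinearMap.mk₂ ℝ (fun x y => ∑ w, x.1 w * y.1 w + ∑ w, 2 * (x.2 w * y.2 w).re)
    (fun x x' y => by
      simp only [Prod.fst_add, Prod.snd_add, Pi.add_apply, add_mul, Complex.add_re, mul_add,
        Finset.sum_add_distrib]
      ring)
    (fun c x y => by
      simp only [Prod.smul_fst, Prod.smul_snd, Pi.smul_apply, smul_eq_mul, Complex.real_smul,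
        mul_assoc, Complex.re_ofReal_mul, Finset.mul_sum, mul_add]
      congr 1
      exact Finset.sum_congr rfl fun w _ => by ring)
    (fun x y y' => by
      simp only [Prod.fst_add, Prod.snd_add, Pi.add_apply, mul_add, Complex.add_re,
        Finset.sum_add_distrib]
      ring)
    (fun c x y => by
      simp only [Prod.smul_fst, Prod.smul_snd, Pi.smul_apply, smul_eq_mul, Complex.real_smul,
        mul_left_comm _ (c : ℂ), mul_left_comm _ c, Complex.re_ofReal_mul, Finset.mul_sum, mul_add])

theorem traceFormCoord_apply (x y : CoordSpace A) :
    traceFormCoord x y = ∑ w, x.1 w * y.1 w + ∑ w, 2 * (x.2 w * y.2 w).re := rfl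

theorem traceFormCoord_coords [Fintype (A →+* ℂ)] (x y : Arch A) :
    ((traceFormCoord (coords A x) (coords A y) : ℝ) : ℂ) = ∑ σ, x.1 σ * y.1 σ := by
  rw [sum_ringHom_eq_sum_place, traceFormCoord_apply]
  push_cast
  congr 1
  · refine Finset.sum_congr rfl fun w _ => ?_
    have hre : ∀ z : Arch A, ((z.1 w.1.hom).re : ℂ) = z.1 w.1.hom := by
      intro z
      have h := z.2 w.1.hom
      rw [w.2] at h
      exact Complex.conj_eq_iff_re.1 h.symm
    simp only [coords, hre]
  · refine Finset.sum_congr rfl fun w _ => ?_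
    rw [x.2, y.2, ← map_mul, Complex.add_conj]
    simp only [coords]
    push_cast
    rfl

open Classical in
/-- The standard real basis of the space of coordinates, with `1` and `i` at each complex place. -/
def stdBasis (A : Type*) [CommRing A] [Fintype (RealPlace A)] [Fintype (ComplexPlace A)] :
    Basis (RealPlace A ⊕ ComplexPlace A × Fin 2) ℝ (CoordSpace A) :=
  Basis.prod (Pi.basisFun ℝ _)
    (Basis.reindex (Pi.basis fun _ => Complex.basisOneI) (Equiv.sigmaEquivProd _ _))

open Classical in
theorem volume_fundamentalDomain_stdBasis :
    MeasureTheory.volume (ZSpan.fundamentalDomain (stdBasis A)) = 1 := by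
  have : ZSpan.fundamentalDomain (stdBasis A) =
      (Set.univ.pi fun _ => Set.Ico 0 1) ×ˢ
      (Set.univ.pi fun _ => Complex.measurableEquivPi ⁻¹' (Set.univ.pi fun _ => Set.Ico 0 1)) := by
    ext
    simp [stdBasis, ZSpan.mem_fundamentalDomain, Complex.measurableEquivPi]
  rw [this, MeasureTheory.Measure.volume_eq_prod, MeasureTheory.Measure.prod_prod,
    MeasureTheory.volume_pi, MeasureTheory.volume_pi, MeasureTheory.Measure.pi_pi,
    MeasureTheory.Measure.pi_pi,
    Complex.volume_preserving_equiv_pi.measure_preimage ?_, MeasureTheory.volume_pi,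
    MeasureTheory.Measure.pi_pi, Real.volume_Ico,
    sub_zero, ENNReal.ofReal_one, Finset.prod_const_one, Finset.prod_const_one,
    Finset.prod_const_one, one_mul]
  exact (MeasurableSet.pi Set.countable_univ (fun _ _ => measurableSet_Ico)).nullMeasurableSet

open Classical in
theorem abs_det_traceFormCoord_stdBasis :
    |(LinearMap.BilinForm.toMatrix (stdBasis A) traceFormCoord).det| =
      (2 ^ Nat.card (ComplexPlace A)) ^ 2 := by
  let d : RealPlace A ⊕ ComplexPlace A × Fin 2 → ℝ :=
    Sum.elim (fun _ => 1) (fun p => if p.2 = 0 then 2 else -2)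
  have hdiag : LinearMap.BilinForm.toMatrix (stdBasis A) traceFormCoord = Matrix.diagonal d := by
    ext i j
    rw [LinearMap.BilinForm.toMatrix_apply, traceFormCoord_apply, Matrix.diagonal_apply]
    rcases i with i | ⟨i, k⟩ <;> rcases j with j | ⟨j, l⟩
    · simp [stdBasis, d, Pi.single_apply, eq_comm]
    · simp [stdBasis, d]
    · simp [stdBasis, d]
    · by_cases hij : i = j
      · subst hij
        fin_cases k <;> fin_cases l <;> simp [stdBasis, d, Pi.single_apply, apply_ite]
      · simp [stdBasis, d, hij, Pi.single_apply, apply_ite]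
        intro h
        exact absurd h.symm hij
  rw [hdiag, Matrix.det_diagonal, Finset.abs_prod, Fintype.prod_sum_type, Fintype.prod_prod_type]
  simp [d, Nat.card_eq_fintype_card, Fin.prod_univ_two, ← pow_mul, mul_comm]
  rw [pow_mul, pow_two]

end Form

end ArchLattice

end

/-! ### Covolumes -/

noncomputable section

namespace ArchLattice

variable {A : Type*} [CommRing A]

/-- The diagonal embedding `A → A_∞` in coordinates. -/
def embed (A : Type*) [CommRing A] : A →+ CoordSpace A :=
  (coordsEquiv (A := A)).toLinearMap.toAddMonoidHom.comp (diag A).toAddMonoidHom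

theorem embed_apply (x : A) : embed A x = coords A (diag A x) := rfl

variable [Algebra ℚ A]

theorem embed_rat_smul (c : ℚ) (x : A) : embed A (c • x) = (c : ℝ) • embed A x := by
  have : diag A (c • x) = (c : ℝ) • diag A x := by
    ext σ
    change σ (c • x) = ((c : ℝ) : ℝ) • σ x
    rw [Algebra.smul_def, map_mul, ← RingHom.comp_apply, eq_ratCast (σ.comp (algebraMap ℚ A)) c,
      Complex.real_smul]
    push_cast
    rfl
  rw [embed_apply, this]
  exact map_smul (coordsEquiv (A := A)) _ _

theorem embed_sum_smul {ι : Type*} (s : Finset ι) (c : ι → ℚ) (a : ι → A) :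
    embed A (∑ k ∈ s, c k • a k) = ∑ k ∈ s, (c k : ℝ) • embed A (a k) := by
  rw [map_sum]
  exact Finset.sum_congr rfl fun k _ => embed_rat_smul _ _

variable [Fintype (A →+* ℂ)] [Fintype (RealPlace A)] [Fintype (ComplexPlace A)]
  [Module.Finite ℚ A] [Algebra.Etale ℚ A]

variable (A) in
theorem finrank_coordSpace : finrank ℝ (CoordSpace A) = finrank ℚ A := by
  have h := sum_ringHom_eq_sum_place (A := A) fun _ => 1
  rw [← card_ringHom_complex A, Nat.card_eq_fintype_card]
  simp only [Finset.sum_const, Finset.card_univ, nsmul_eq_mul, mul_one] at h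
  have h' : Fintype.card (A →+* ℂ) =
      Fintype.card (RealPlace A) + Fintype.card (ComplexPlace A) * 2 := by
    have : ((Fintype.card (A →+* ℂ) : ℕ) : ℂ) =
      ((Fintype.card (RealPlace A) + Fintype.card (ComplexPlace A) * 2 : ℕ) : ℂ) := by
      rw [h]; push_cast; ring
    exact_mod_cast this
  rw [h', finrank_eq_card_basis (stdBasis A)]
  simp

theorem traceFormCoord_embed (x y : A) :
    traceFormCoord (embed A x) (embed A y) = (Algebra.trace ℚ A (x * y) : ℝ) := by
  have h := traceFormCoord_coords (diag A x) (diag A y)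
  have h2 : ∑ σ, (diag A x).1 σ * (diag A y).1 σ = ∑ σ : A →+* ℂ, σ (x * y) :=
    Finset.sum_congr rfl fun σ _ => (map_mul σ x y).symm
  rw [h2, ← trace_eq_sum_ringHom_complex] at h
  exact_mod_cast h

section Basis

variable {ι : Type*} [Fintype ι] [DecidableEq ι] (a : Basis ι ℚ A)

/-- A `ℚ`-basis of `A` is linearly independent in `A_∞`, because the Gram matrix of the trace form is
invertible. -/
theorem linearIndependent_embed : LinearIndependent ℝ fun k => embed A (a k) := by
  rw [Fintype.linearIndependent_iff]
  intro c hc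
  have hdet : ((Algebra.traceMatrix ℚ a).map (Rat.castHom ℝ)).det ≠ 0 := by
    rw [← RingHom.mapMatrix_apply, ← RingHom.map_det, ← Algebra.discr_def]
    simpa using discr_ne_zero_of_etale a
  have hmul : ((Algebra.traceMatrix ℚ a).map (Rat.castHom ℝ)).mulVec c = 0 := by
    ext l
    simp only [Matrix.mulVec, dotProduct, Matrix.map_apply, Algebra.traceMatrix_apply,
      Algebra.traceForm_apply, Rat.coe_castHom, ← traceFormCoord_embed, Pi.zero_apply]
    have := congrArg (traceFormCoord (embed A (a l))) hc
    rw [map_sum, map_zero] at this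
    rw [← this]
    exact Finset.sum_congr rfl fun k _ => by rw [map_smul, smul_eq_mul, mul_comm]
  exact fun i => congrFun (Matrix.eq_zero_of_mulVec_eq_zero hdet hmul) i

/-- The real basis of `A_∞`, in coordinates, given by a `ℚ`-basis of `A`. -/
def embedBasis : Basis ι ℝ (CoordSpace A) :=
  Basis.mk (linearIndependent_embed a) (ge_of_eq
    ((linearIndependent_embed a).span_eq_top_of_card_eq_finrank'
      (by rw [finrank_coordSpace, finrank_eq_card_basis a])))

@[simp]
theorem embedBasis_apply (k : ι) : embedBasis a k = embed A (a k) := by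
  simp [embedBasis]

theorem embedBasis_repr_embed (x : A) (k : ι) : (embedBasis a).repr (embed A x) k = a.repr x k := by
  have : embed A x = ∑ k, (a.repr x k : ℝ) • embedBasis a k := by
    conv_lhs => rw [← a.sum_repr x]
    rw [embed_sum_smul]
    simp
  rw [this, Basis.repr_sum_self]

theorem mem_span_int_embedBasis (y : CoordSpace A) :
    y ∈ Submodule.span ℤ (Set.range (embedBasis a)) ↔
      ∃ x ∈ Submodule.span ℤ (Set.range a), embed A x = y := by
  have : Set.range (embedBasis a) = (embed A).toIntLinearMap '' Set.range a := by
    rw [← Set.range_comp]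
    congr 1
    ext k : 1
    simp
  rw [this, ← Submodule.map_span, Submodule.mem_map]
  rfl

theorem embed_injective : Function.Injective (embed A) := by
  rw [injective_iff_map_eq_zero]
  intro x hx
  let b := finBasis ℚ A
  refine b.repr.map_eq_zero_iff.1 (Finsupp.ext fun k => ?_)
  have h := embedBasis_repr_embed b x k
  rw [hx] at h
  simpa using h.symm

open MeasureTheory in
instance isAddHaarMeasure_volume_coordSpace (A : Type*) [CommRing A] [Fintype (RealPlace A)]
    [Fintype (ComplexPlace A)] : (volume : Measure (CoordSpace A)).IsAddHaarMeasure :=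
  Measure.prod.instIsAddHaarMeasure volume volume

open MeasureTheory in
/-- The square of the covolume of a lattice in `A`, for the normalised measure, is the absolute value
of the discriminant. Both sides scale alike under a change of real basis, and for the standard basis
they agree, as the trace form has the values `1` or `2, -2` on it. -/
theorem sq_volume_fundamentalDomain_embedBasis :
    (2 ^ Nat.card (ComplexPlace A) * volume.real (ZSpan.fundamentalDomain (embedBasis a))) ^ 2 =
      |(Algebra.discr ℚ a : ℝ)| := by
  classical
  have hcard : Fintype.card (RealPlace A ⊕ ComplexPlace A × Fin 2) = Fintype.card ι := by
    rw [← finrank_eq_card_basis (stdBasis A), ← finrank_eq_card_basis (embedBasis a)]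
  let e := Fintype.equivOfCardEq hcard
  let s := (stdBasis A).reindex e
  have hvol : volume.real (ZSpan.fundamentalDomain s) = 1 := by
    rw [ZSpan.fundamentalDomain_reindex, measureReal_def, volume_fundamentalDomain_stdBasis]
    rfl
  have hdets : |(LinearMap.BilinForm.toMatrix s traceFormCoord).det| =
      (2 ^ Nat.card (ComplexPlace A)) ^ 2 := by
    rw [← abs_det_traceFormCoord_stdBasis (A := A)]
    congr 1
    rw [← Matrix.det_submatrix_equiv_self e]
    congr 1
    ext i j
    simp [LinearMap.BilinForm.toMatrix_apply, s]
  have hdisc : (Algebra.discr ℚ a : ℝ) =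
      (LinearMap.BilinForm.toMatrix (embedBasis a) traceFormCoord).det := by
    rw [Algebra.discr_def, ← Rat.coe_castHom, RingHom.map_det]
    congr 1
    ext i j
    rw [LinearMap.BilinForm.toMatrix_apply, embedBasis_apply, embedBasis_apply,
      traceFormCoord_embed]
    rfl
  rw [ZSpan.measureReal_fundamentalDomain _ volume s, hvol, mul_one, hdisc,
    ← LinearMap.BilinForm.toMatrix_mul_basis_toMatrix s (embedBasis a), Matrix.det_mul,
    Matrix.det_mul, Matrix.det_transpose, abs_mul, abs_mul, hdets, Basis.det_apply]
  ring

end Basis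

end ArchLattice

end

/-! ### The norm attached to a linear map -/

noncomputable section

namespace ArchLattice

section ArchNorm

variable {A : Type*} [CommRing A] [Fintype (A →+* ℂ)]

/-- The norm on `A_∞`, in coordinates, whose unit ball is `B'_∞ = τ⁻¹ B_∞` (a seminorm only, if `τ`
is not injective). -/
def archNorm (τ : Arch A →ₗ[ℝ] Arch A) : Seminorm ℝ (CoordSpace A) :=
  (normSeminorm ℝ ((A →+* ℂ) → ℂ)).comp
    ((Arch A).val.toLinearMap ∘ₗ τ ∘ₗ (coordsEquiv (A := A)).symm.toLinearMap)

theorem archNorm_coords (τ : Arch A →ₗ[ℝ] Arch A) (x : Arch A) :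
    archNorm τ (coords A x) = ‖(τ x).1‖ := by
  have : (coordsEquiv (A := A)).symm (coords A x) = x := (coordsEquiv (A := A)).symm_apply_apply x
  simp only [archNorm, Seminorm.comp_apply, LinearMap.comp_apply, LinearEquiv.coe_coe, this]
  rfl

theorem mem_unitBall_iff (x : Arch A) : x ∈ unitBall A ↔ ‖x.1‖ ≤ 1 :=
  (pi_norm_le_iff_of_nonneg zero_le_one).symm

theorem archNorm_le_of_mem_smul_ball {τ : Arch A →ₗ[ℝ] Arch A} {r : ℝ} (hr : 0 ≤ r) {x : Arch A}
    (hx : x ∈ r • ball τ) : archNorm τ (coords A x) ≤ r := by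
  obtain ⟨y, hy, rfl⟩ := hx
  have hy' : ‖(τ y).1‖ ≤ 1 := (mem_unitBall_iff _).1 hy
  have h2 : (τ (r • y)).1 = r • (τ y).1 := by rw [map_smul]; rfl
  rw [archNorm_coords]
  change ‖(τ (r • y)).1‖ ≤ r
  rw [h2, norm_smul, Real.norm_of_nonneg hr]
  exact mul_le_of_le_one_right hr hy'

theorem mem_smul_ball_iff {τ : Arch A →ₗ[ℝ] Arch A} {r : ℝ} (hr : 0 < r) {x : Arch A} :
    x ∈ r • ball τ ↔ archNorm τ (coords A x) ≤ r := by
  refine ⟨archNorm_le_of_mem_smul_ball hr.le, fun h => ?_⟩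
  rw [archNorm_coords] at h
  rw [Set.mem_smul_set_iff_inv_smul_mem₀ hr.ne']
  have h2 : (τ (r⁻¹ • x)).1 = r⁻¹ • (τ x).1 := by rw [map_smul]; rfl
  change τ (r⁻¹ • x) ∈ unitBall A
  rw [mem_unitBall_iff, h2, norm_smul, Real.norm_of_nonneg (inv_nonneg.2 hr.le),
    inv_mul_le_iff₀ hr, mul_one]
  exact h

theorem injective_comp_coordsEquiv_symm {A : Type*} [CommRing A] {τ : Arch A →ₗ[ℝ] Arch A}
    (hτ : Function.Injective τ) : Function.Injective
    ((Arch A).val.toLinearMap ∘ₗ τ ∘ₗ (coordsEquiv (A := A)).symm.toLinearMap) :=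
  (Subtype.val_injective.comp hτ).comp (coordsEquiv (A := A)).symm.injective

theorem archNorm_pos {τ : Arch A →ₗ[ℝ] Arch A} (hτ : Function.Injective τ)
    {y : CoordSpace A} (hy : y ≠ 0) : 0 < archNorm τ y := by
  have := (map_ne_zero_iff _ (injective_comp_coordsEquiv_symm hτ)).2 hy
  exact norm_pos_iff.2 this

theorem isBounded_archNorm_le [Fintype (RealPlace A)] [Fintype (ComplexPlace A)]
    {τ : Arch A →ₗ[ℝ] Arch A} (hτ : Function.Injective τ) (r : ℝ) :
    Bornology.IsBounded {y : CoordSpace A | archNorm τ y ≤ r} := by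
  obtain ⟨K, -, hK⟩ := LinearMap.exists_antilipschitzWith
    ((Arch A).val.toLinearMap ∘ₗ τ ∘ₗ (coordsEquiv (A := A)).symm.toLinearMap)
    (LinearMap.ker_eq_bot.2 (injective_comp_coordsEquiv_symm hτ))
  refine (hK.isBounded_preimage (Metric.isBounded_closedBall (x := 0) (r := r))).subset ?_
  intro y hy
  rw [Set.mem_preimage, mem_closedBall_zero_iff]
  exact hy

end ArchNorm

section Lattice

variable {F A : Type*} [Field F] [NumberField F] [CommRing A] [Algebra F A] [Module.Finite F A]

theorem exists_int_basis [Algebra ℚ A] [IsScalarTower ℚ F A]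
    {L : Submodule (𝓞 F) A} (hL : IsLattice F L) :
    ∃ a : Basis (Fin (finrank F A) × Free.ChooseBasisIndex ℤ (𝓞 F)) ℚ A,
      (∀ x, x ∈ Submodule.span ℤ (Set.range a) ↔ x ∈ L) ∧
      |(Algebra.discr ℚ a : ℝ)| =
        |(NumberField.discr F : ℝ)| ^ finrank F A * latticeDet F L hL.1 ^ 2 := by
  obtain ⟨a, h1, h2, h3⟩ := exists_int_generators hL
  have hcard : Fintype.card (Fin (finrank F A) × Free.ChooseBasisIndex ℤ (𝓞 F)) =
      finrank ℚ A := by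
    rw [Fintype.card_prod, Fintype.card_fin, ← finrank_eq_card_chooseBasisIndex,
      NumberField.RingOfIntegers.rank, mul_comm, finrank_mul_finrank]
  refine ⟨Basis.mk (linearIndependent_of_top_le_span_of_card_eq_finrank h2.ge hcard) h2.ge, ?_⟩
  rw [Basis.coe_mk]
  exact ⟨h1, h3⟩

/-- The `ℚ`-basis of `A` formed by the products of an `F`-basis of `A` and an integral basis of
`F`. -/
def latticeFrame {F A : Type*} [Field F] [NumberField F] [CommRing A] [Algebra F A]
    [Algebra ℚ A] [IsScalarTower ℚ F A] (x : Basis (Fin (finrank F A)) F A) :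
    Basis (Fin (finrank F A) × Free.ChooseBasisIndex ℤ (𝓞 F)) ℚ A :=
  ((NumberField.integralBasis F).smulTower x).reindex (Equiv.prodComm _ _)

theorem latticeFrame_apply {F A : Type*} [Field F] [NumberField F] [CommRing A] [Algebra F A]
    [Algebra ℚ A] [IsScalarTower ℚ F A] (x : Basis (Fin (finrank F A)) F A)
    (k : Fin (finrank F A) × Free.ChooseBasisIndex ℤ (𝓞 F)) :
    latticeFrame x k = (NumberField.RingOfIntegers.basis F k.2) • x k.1 := by
  simp only [latticeFrame, Basis.reindex_apply, Equiv.prodComm_symm, Equiv.prodComm_apply,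
    Basis.smulTower_apply, Prod.fst_swap, Prod.snd_swap, NumberField.integralBasis_apply]
  exact algebraMap_smul F _ _

theorem archNorm_smul_le {F A : Type*} [Field F] [CommRing A] [Algebra F A]
    [Fintype (A →+* ℂ)] {τ : Arch A →ₗ[ℝ] Arch A}
    (hτ : IsArchLinear F τ) {M : ℝ} (hM : 0 ≤ M) {c : F} (hc : ∀ ρ : F →+* ℂ, ‖ρ c‖ ≤ M) (x : A) :
    archNorm τ (embed A (c • x)) ≤ M * archNorm τ (embed A x) := by
  have h1 : diag A (c • x) = baseMap F A (diag F c) * diag A x := by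
    ext σ
    change σ (c • x) = σ (algebraMap F A c) * σ x
    rw [Algebra.smul_def, map_mul]
  rw [embed_apply, embed_apply, archNorm_coords, archNorm_coords, h1, hτ,
    pi_norm_le_iff_of_nonneg (by positivity)]
  intro σ
  change ‖σ (algebraMap F A c) * (τ (diag A x)).1 σ‖ ≤ _
  rw [norm_mul]
  exact mul_le_mul (hc (σ.comp (algebraMap F A))) (norm_le_pi_norm _ σ) (norm_nonneg _) hM

variable [Algebra ℚ A] [IsScalarTower ℚ F A] [Algebra.Etale ℚ A] [Fintype (A →+* ℂ)]
  [Fintype (RealPlace A)] [Fintype (ComplexPlace A)] {L : Submodule (𝓞 F) A}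
  {τ : Arch A →ₗ[ℝ] Arch A} {κ' : Type*} [Fintype κ'] [DecidableEq κ']

theorem finite_archNorm_le (hτ : Function.Injective τ) (a : Basis κ' ℚ A)
    (ha : ∀ x, x ∈ Submodule.span ℤ (Set.range a) ↔ x ∈ L) (r : ℝ) :
    {x | x ∈ (L : Set A) ∧ archNorm τ (embed A x) ≤ r}.Finite := by
  have : Module.Finite ℚ A := Module.Finite.trans F A
  refine Set.Finite.of_finite_image ((ZSpan.setFinite_inter (embedBasis a)
    (isBounded_archNorm_le hτ r)).subset ?_) (embed_injective (A := A)).injOn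
  rintro _ ⟨x, hx, rfl⟩
  exact ⟨hx.2, (mem_span_int_embedBasis a _).2 ⟨x, (ha x).2 hx.1, rfl⟩⟩

theorem succMin_eq_of_isGreedy (hτ : Function.Injective τ) {m : ℕ} {x : Fin m → A}
    (hx : IsGreedy F (L : Set A) (fun y => archNorm τ (embed A y)) x) (i : Fin m) :
    succMin F L (ball τ) (i + 1) = archNorm τ (embed A (x i)) := by
  have : Module.Finite ℚ A := Module.Finite.trans F A
  have hset : {r : ℝ | 0 < r ∧ ∃ x : Fin (i + 1) → A, LinearIndependent F x ∧
      ∀ j, x j ∈ L ∧ diag A (x j) ∈ r • ball τ} =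
      {r : ℝ | 0 < r ∧ ∃ y : Fin (i + 1) → A, LinearIndependent F y ∧
      ∀ j, y j ∈ (L : Set A) ∧ archNorm τ (embed A (y j)) ≤ r} := by
    ext r
    refine and_congr_right fun hr => exists_congr fun y => and_congr_right fun _ =>
      forall_congr' fun j => and_congr_right fun _ => ?_
    rw [mem_smul_ball_iff hr, embed_apply]
  rw [succMin, hset]
  exact (hx.isLeast (fun y _ hy => archNorm_pos hτ
    ((map_ne_zero_iff _ embed_injective).2 hy)) i).csInf_eq

/-- Multiplying vectors that attain the successive minima by an integral basis of `F` gives a reduced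
frame. The map `τ` is `F_∞`-linear, so that multiplication by an integer of `F` changes the norm by
at most the largest of its absolute values. -/
theorem isReducedFrame_latticeFrame (hτ : Function.Injective τ) (hτF : IsArchLinear F τ)
    (a : Basis κ' ℚ A) (ha : ∀ x, x ∈ Submodule.span ℤ (Set.range a) ↔ x ∈ L)
    {x : Basis (Fin (finrank F A)) F A}
    (hx : IsGreedy F (L : Set A) (fun y => archNorm τ (embed A y)) x) {M : ℝ} (hM : 0 ≤ M)
    (hMF : ∀ (ρ : F →+* ℂ) j, ‖ρ (NumberField.RingOfIntegers.basis F j)‖ ≤ M) :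
    haveI : Module.Finite ℚ A := Module.Finite.trans F A
    IsReducedFrame (archNorm τ) (Submodule.span ℤ (Set.range (embedBasis a)))
      (embedBasis (latticeFrame x)) (fun k => archNorm τ (embed A (x k.1))) M := by
  have : Module.Finite ℚ A := Module.Finite.trans F A
  refine ⟨fun k => archNorm_pos hτ ((map_ne_zero_iff _ embed_injective).2 (x.ne_zero _)),
    fun k => ?_, fun k => ?_, ?_⟩
  · rw [embedBasis_apply, mem_span_int_embedBasis]
    refine ⟨latticeFrame x k, (ha _).2 ?_, rfl⟩
    rw [latticeFrame_apply]
    exact L.smul_mem _ (hx.mem _)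
  · rw [embedBasis_apply, latticeFrame_apply, ← algebraMap_smul F]
    exact archNorm_smul_le hτF hM (fun ρ => hMF ρ _) _
  · intro y hy k hk
    obtain ⟨y, hyL, rfl⟩ := (mem_span_int_embedBasis a _).1 hy
    rw [embedBasis_repr_embed] at hk
    refine hx.le_of_repr_ne_zero ((ha y).1 hyL) fun h0 => hk ?_
    rw [latticeFrame, Basis.repr_reindex_apply, Basis.smulTower_repr]
    simp [h0]

end Lattice

end ArchLattice

end

/-! ### The counting theorem -/

theorem etale_rat_of_etale (F A : Type*) [Field F] [NumberField F] [CommRing A] [Algebra F A]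
    [Algebra ℚ A] [IsScalarTower ℚ F A] [Algebra.Etale F A] : Algebra.Etale ℚ A := by
  have : Algebra.Etale ℚ F := ⟨Algebra.FormallyEtale.of_isSeparable ℚ F,
    Algebra.FinitePresentation.of_finiteType.1 inferInstance⟩
  exact Algebra.Etale.comp ℚ F A

theorem exists_norm_basis_le (F : Type*) [Field F] [NumberField F] :
    ∃ M : ℝ, 0 ≤ M ∧
      ∀ (ρ : F →+* ℂ) j, ‖ρ (NumberField.RingOfIntegers.basis F j)‖ ≤ M := by
  refine ⟨∑ ρ : F →+* ℂ, ∑ j, ‖ρ (NumberField.RingOfIntegers.basis F j)‖, by positivity,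
    fun ρ j => ?_⟩
  exact (Finset.single_le_sum (f := fun j => ‖ρ (NumberField.RingOfIntegers.basis F j)‖)
    (fun j _ => norm_nonneg _) (Finset.mem_univ j)).trans
    (Finset.single_le_sum (f := fun ρ : F →+* ℂ =>
      ∑ j, ‖ρ (NumberField.RingOfIntegers.basis F j)‖)
      (fun ρ _ => by positivity) (Finset.mem_univ ρ))

theorem ArchLattice.frontier_coords {A : Type*} [CommRing A] [Finite (A →+* ℂ)]
    (S : Set (ArchLattice.Arch A)) :
    frontier (ArchLattice.coords A '' S) = ArchLattice.coords A '' frontier S := by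
  have : FiniteDimensional ℝ (ArchLattice.Arch A) :=
    inferInstanceAs (FiniteDimensional ℝ (Subalgebra.toSubmodule (ArchLattice.Arch A)))
  have : IsTopologicalAddGroup (ArchLattice.Arch A) :=
    inferInstanceAs (IsTopologicalAddGroup (Subalgebra.toSubmodule (ArchLattice.Arch A)))
  have : ContinuousSMul ℝ (ArchLattice.Arch A) :=
    inferInstanceAs (ContinuousSMul ℝ (Subalgebra.toSubmodule (ArchLattice.Arch A)))
  exact ((ArchLattice.coordsEquiv (A := A)).toContinuousLinearEquiv.toHomeomorph.image_frontier
    S).symm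

theorem prod_fin_prod_eq {κ : Type*} [Fintype κ] (n : ℕ) (h : ℕ → ℝ) :
    ∏ k : Fin n × κ, h (k.1 + 1) = ∏ i ∈ Finset.Icc 1 n, h i ^ Fintype.card κ := by
  rw [Fintype.prod_prod_type]
  simp only [Finset.prod_const, Finset.card_univ]
  rw [Fin.prod_univ_eq_prod_range (fun i => h (i + 1) ^ Fintype.card κ) n,
    Finset.range_eq_Ico, Finset.prod_Ico_add' (fun i => h i ^ Fintype.card κ) 0 n 1]
  rfl

theorem mainTheorem9 (F : Type*) [Field F] [NumberField F] (n : ℕ) (hn : 1 ≤ n) :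
    ∃ C : ℝ,
      ∀ (A : Type*) [CommRing A] [Algebra F A] [Module.Finite F A] [Algebra.Etale F A]
        (_ : Module.finrank F A = n)
        (L : Submodule (𝓞 F) A) (hL : ArchLattice.IsLattice F L)
        (τ : ArchLattice.Arch A →ₗ[ℝ] ArchLattice.Arch A)
        (_ : ArchLattice.IsArchLinear F τ) (_ : LinearMap.det τ = 1)
        (S : Set (ArchLattice.Arch A))
        (_ : ∃ r : ℝ, ∀ x ∈ S, ∀ σ, ‖x.1 σ‖ ≤ r)
        (R : ℝ) (_ : 0 ≤ R) (N : ℕ)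
        (_ : ArchLattice.InLip (ArchLattice.ball τ) (n * Module.finrank ℚ F - 1) R N (frontier S)),
        {x : A | x ∈ L ∧ ArchLattice.diag A x ∈ S}.Finite ∧
        |({x : A | x ∈ L ∧ ArchLattice.diag A x ∈ S}.ncard : ℝ)
            - ArchLattice.vol F S /
              (|(NumberField.discr F : ℝ)| ^ ((n : ℝ) / 2) * ArchLattice.latticeDet F L hL.1)|
          ≤ C * N *
            (R ^ (n * Module.finrank ℚ F - 1) /
                ((∏ j ∈ Finset.Icc 1 (n - 1),
                    ArchLattice.succMin F L (ArchLattice.ball τ) j) ^ Module.finrank ℚ F *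
                  ArchLattice.succMin F L (ArchLattice.ball τ) n ^ (Module.finrank ℚ F - 1)) +
              ∑ i ∈ Finset.range n,
                R ^ (i * Module.finrank ℚ F) /
                  (∏ j ∈ Finset.Icc 1 i,
                    ArchLattice.succMin F L (ArchLattice.ball τ) j) ^ Module.finrank ℚ F) := by
  classical
  obtain ⟨M, hM, hMF⟩ := exists_norm_basis_le F
  set d := finrank ℚ F with hd
  have hd1 : 1 ≤ d := finrank_pos
  let m := n * d - 1
  refine ⟨IsReducedFrame.tileBound (n * d) M ^ (n * d) * (2 ^ m * ((m : ℝ) + 1) ^ (n * d)), ?_⟩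
  intro A _ _ _ _ hA L hL τ hτF hdet S hS R hR N hLip
  subst hA
  let _ : Algebra ℚ A := Algebra.compHom A (algebraMap ℚ F)
  have : IsScalarTower ℚ F A := IsScalarTower.of_algebraMap_eq fun _ => rfl
  have : Algebra.Etale ℚ A := etale_rat_of_etale F A
  have : Module.Finite ℚ A := Module.Finite.trans F A
  have := ArchLattice.finite_hom F A
  have := ArchLattice.finite_place F A
  let _ : Fintype (A →+* ℂ) := Fintype.ofFinite _
  let _ : Fintype (ArchLattice.RealPlace A) := Fintype.ofFinite _
  let _ : Fintype (ArchLattice.ComplexPlace A) := Fintype.ofFinite _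
  have hτ : Function.Injective τ :=
    (LinearMap.equivOfDetNeZero τ (by rw [hdet]; exact one_ne_zero)).injective
  obtain ⟨a, ha, hdisc⟩ := ArchLattice.exists_int_basis hL
  -- vectors that attain the successive minima, and the frame built from them
  obtain ⟨x, hx⟩ := exists_isGreedy hL.2 (ArchLattice.finite_archNorm_le hτ a ha) le_rfl
  let xb : Basis (Fin (finrank F A)) F A := Basis.mk hx.linearIndependent
    (hx.linearIndependent.span_eq_top_of_card_eq_finrank' (by simp)).ge
  have hxb : IsGreedy F (L : Set A) (fun y => ArchLattice.archNorm τ (ArchLattice.embed A y)) xb := by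
    rw [Basis.coe_mk]; exact hx
  have hframe := ArchLattice.isReducedFrame_latticeFrame hτ hτF a ha hxb hM hMF
  set lam : ℕ → ℝ := ArchLattice.succMin F L (ArchLattice.ball τ) with hlam
  have hlamx : ∀ i : Fin (finrank F A),
      ArchLattice.archNorm τ (ArchLattice.embed A (xb i)) = lam (i + 1) := fun i =>
    (ArchLattice.succMin_eq_of_isGreedy hτ hxb i).symm
  have hlam' : ∀ i ∈ Finset.Icc 1 (finrank F A), ∃ k : Fin (finrank F A), i = k + 1 := by
    intro i hi
    rw [Finset.mem_Icc] at hi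
    exact ⟨⟨i - 1, by omega⟩, by simp only; omega⟩
  have hpos : ∀ i ∈ Finset.Icc 1 (finrank F A), 0 < lam i := by
    intro i hi
    obtain ⟨k, rfl⟩ := hlam' i hi
    rw [← hlamx]
    exact ArchLattice.archNorm_pos hτ ((map_ne_zero_iff _ ArchLattice.embed_injective).2
      (xb.ne_zero k))
  have hmono : ∀ i ∈ Finset.Icc 1 (finrank F A), ∀ j ∈ Finset.Icc 1 (finrank F A), i ≤ j →
      lam i ≤ lam j := by
    intro i hi j hj hij
    obtain ⟨k, rfl⟩ := hlam' i hi
    obtain ⟨l, rfl⟩ := hlam' j hj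
    rw [← hlamx, ← hlamx]
    exact hxb.monotone (Fin.le_def.2 (by omega))
  -- transport the region and the parametrisation of its frontier to real coordinates
  obtain ⟨φ, hφ, hcov⟩ := hLip
  have hφ' : ∀ k, ∀ u ∈ ArchLattice.cube m, ∀ v ∈ ArchLattice.cube m,
      ArchLattice.archNorm τ (ArchLattice.coords A (φ k u) - ArchLattice.coords A (φ k v)) ≤
        R * ‖u - v‖ := by
    intro k u hu v hv
    have := ArchLattice.archNorm_le_of_mem_smul_ball (by positivity) (hφ k u hu v hv)
    rwa [show ArchLattice.coords A (φ k u - φ k v) =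
      ArchLattice.coords A (φ k u) - ArchLattice.coords A (φ k v) from
      map_sub ArchLattice.coordsLinear _ _] at this
  set S' := ArchLattice.coords A '' S with hS'
  have hcov' : frontier S' ⊆ ⋃ k, (fun u => ArchLattice.coords A (φ k u)) '' ArchLattice.cube m := by
    rw [hS', ArchLattice.frontier_coords]
    rintro _ ⟨y, hy, rfl⟩
    obtain ⟨k, u, hu, rfl⟩ := Set.mem_iUnion.1 (hcov hy)
    exact Set.mem_iUnion.2 ⟨k, u, hu, rfl⟩
  have hS'b : Bornology.IsBounded S' := by
    obtain ⟨r, hr⟩ := hS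
    refine (Metric.isBounded_closedBall (x := (0 : ArchLattice.CoordSpace A))
      (r := max r 0)).subset ?_
    rintro _ ⟨y, hy, rfl⟩
    rw [mem_closedBall_zero_iff, norm_prod_le_iff, pi_norm_le_iff_of_nonneg (le_max_right _ _),
      pi_norm_le_iff_of_nonneg (le_max_right _ _)]
    exact ⟨fun w => ((Complex.abs_re_le_norm _).trans (hr y hy _)).trans (le_max_left _ _),
      fun w => (hr y hy _).trans (le_max_left _ _)⟩
  obtain ⟨K, hK, hKle⟩ := exists_subdivision_le lam hd1 hn hR (Nat.cast_nonneg m) hpos hmono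
  obtain ⟨hbad, hbadcard⟩ := hframe.ncard_tiles_meeting_le hM hR
    (fun k u => ArchLattice.coords A (φ k u)) hφ' hcov' hK
  obtain ⟨hfin, hcount⟩ := abs_ncard_sub_measure_div_le MeasureTheory.volume
    (ArchLattice.embedBasis a) (ArchLattice.embedBasis (ArchLattice.latticeFrame xb))
    hframe.mem hS'b hbad
  -- lattice points of `S` and of its image correspond
  have himg : {y | y ∈ Submodule.span ℤ (Set.range (ArchLattice.embedBasis a)) ∧ y ∈ S'} =
      ArchLattice.embed A '' {x : A | x ∈ L ∧ ArchLattice.diag A x ∈ S} := by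
    ext y
    constructor
    · rintro ⟨hy, s, hs, hsy⟩
      obtain ⟨z, hz, rfl⟩ := (ArchLattice.mem_span_int_embedBasis a _).1 hy
      refine ⟨z, ⟨(ha z).1 hz, ?_⟩, rfl⟩
      rw [ArchLattice.embed_apply] at hsy
      rwa [← ArchLattice.coords_injective hsy]
    · rintro ⟨z, ⟨hz, hzS⟩, rfl⟩
      exact ⟨(ArchLattice.mem_span_int_embedBasis a _).2 ⟨z, (ha z).2 hz, rfl⟩, _, hzS, rfl⟩
  rw [himg] at hfin hcount
  rw [Set.ncard_image_of_injective _ ArchLattice.embed_injective] at hcount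
  refine ⟨hfin.of_finite_image ArchLattice.embed_injective.injOn, ?_⟩
  -- the covolume of the lattice
  have hcovol : 2 ^ Nat.card (ArchLattice.ComplexPlace A) * MeasureTheory.volume.real
      (ZSpan.fundamentalDomain (ArchLattice.embedBasis a)) =
      |(NumberField.discr F : ℝ)| ^ ((finrank F A : ℝ) / 2) * ArchLattice.latticeDet F L hL.1 := by
    have hD : 0 ≤ |(NumberField.discr F : ℝ)| := abs_nonneg _
    have hdet0 : 0 ≤ ArchLattice.latticeDet F L hL.1 := Real.sqrt_nonneg _
    refine (pow_left_inj₀ (by positivity) (by positivity) two_ne_zero).1 ?_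
    rw [ArchLattice.sq_volume_fundamentalDomain_embedBasis, hdisc, mul_pow, ← Real.rpow_natCast,
      ← Real.rpow_natCast (_ ^ _) 2, ← Real.rpow_mul hD]
    congr 2
    push_cast
    ring
  have hvol : ArchLattice.vol F S / (|(NumberField.discr F : ℝ)| ^ ((finrank F A : ℝ) / 2) *
      ArchLattice.latticeDet F L hL.1) = MeasureTheory.volume.real S' /
      MeasureTheory.volume.real (ZSpan.fundamentalDomain (ArchLattice.embedBasis a)) := by
    rw [← hcovol]
    exact mul_div_mul_left _ _ (by positivity)
  rw [hvol]
  refine hcount.trans (hbadcard.trans ?_)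
  have hcard : Fintype.card (Fin (finrank F A) × Free.ChooseBasisIndex ℤ (𝓞 F)) =
      finrank F A * d := by
    rw [Fintype.card_prod, Fintype.card_fin, ← finrank_eq_card_chooseBasisIndex,
      NumberField.RingOfIntegers.rank]
  have hcardκ : Fintype.card (Free.ChooseBasisIndex ℤ (𝓞 F)) = d := by
    rw [← finrank_eq_card_chooseBasisIndex, NumberField.RingOfIntegers.rank]
  simp_rw [hlamx]
  rw [hcard, Finset.prod_mul_distrib, Finset.prod_const, Finset.card_univ, hcard,
    prod_fin_prod_eq (finrank F A) (fun i => R * ((m : ℝ) / K) / lam i + 1), hcardκ]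
  have hT := IsReducedFrame.tileBound_nonneg (finrank F A * d) hM
  calc (N : ℝ) * ((K : ℝ) ^ m * (IsReducedFrame.tileBound (finrank F A * d) M ^ (finrank F A * d) *
        ∏ i ∈ Finset.Icc 1 (finrank F A), (R * ((m : ℝ) / K) / lam i + 1) ^ d))
      = N * IsReducedFrame.tileBound (finrank F A * d) M ^ (finrank F A * d) * ((K : ℝ) ^ m *
        ∏ i ∈ Finset.Icc 1 (finrank F A), (R * ((m : ℝ) / K) / lam i + 1) ^ d) := by ring
    _ ≤ _ := mul_le_mul_of_nonneg_left hKle (by positivity)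
    _ = _ := by ring
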